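/- **Conventions.** $\Delta^{op\,m}$ is the product of $m$ copies of $\Delta^{op}$. For $X\in[\Delta^{op\,m+1},\mathrm{Cat}]$, $X_k\in[\Delta^{op\,m},\mathrm{Cat}]$ is the value at $[k]$ in the first direction; for $\underline k\in\Delta^{op\,m}$, $\underline k(r,i)$ is $\underline k$ with $i$-th coordinate replaced by $[r]$. $p:\mathrm{Cat}\to\mathrm{Set}$ is the set of isomorphism classes of objects, $\bar p$ is $p$ applied levelwise, $d$ is the discrete category functor. The multinerve $N_m:[\Delta^{op\,m-1},\mathrm{Cat}]\to[\Delta^{op\,m},\mathrm{Set}]$ is the nerve applied levelwise; it is fully faithful. For $X \in [\Delta^{op\,n-1},\mathrm{Cat}]$ ($n\ge 2$) we write $p^{(n)}X$ for the object, unique up to isomorphism if it exists, with $N_{n-1}(p^{(n)}X)\cong\bar pX$. An internal category is identified with its nerve, so all the structures below are full subcategories of $[\Delta^{op\,n-1},\mathrm{Cat}]$. * *Homotopically discrete $n$-fold categories* $\mathrm{Cat}^n_{hd}$: for $n=1$, equivalence relations (groupoids with at most one morphism between two objects). For $n\ge2$: $X_k\in\mathrm{Cat}^{n-1}_{hd}$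 for all $k$, the Segal maps $X_k\to X_1\times_{X_0}\cdots\times_{X_0}X_1$, $k\ge2$, are isomorphisms, and $p^{(n)}X$ exists and is in $\mathrm{Cat}^{n-1}_{hd}$. For such $X$ put $X^d=p^{(1)}\cdots p^{(n)}X$ (where $p^{(1)}=p$), a set viewed as a constant discrete object, with its canonical map $\gamma:X\to X^d$. * *Weakly globular Tamsamani $n$-categories* $\mathrm{Ta}^n_{wg}$ and *$n$-equivalences*: $\mathrm{Ta}^1_{wg}=\mathrm{Cat}$, with $1$-equivalences the equivalences of categories. For $n\ge 2$: $X_k\in\mathrm{Ta}^{n-1}_{wg}$ for all $k$, $X_0\in\mathrm{Cat}^{n-1}_{hd}$, and the induced Segal maps $X_k\to X_1\times_{X_0^d}\cdots\times_{X_0^d}X_1$, $k\ge2$, are $(n-1)$-equivalences. A map $f:X\to Y$ is an $n$-equivalence if $p^{(n)}f$ and, for all $a,b\in X_0^d$, the map $f(a,b):X(a,b)\to Y(fa,fb)$ are $(n-1)$-equivalences, where $X(a,b)$ is the fibre at $(a,b)$ of $X_1\to X_0\times X_0\to X_0^d\times X_0^d$. * *Weakly globular $n$-fold categories* $\mathrm{Cat}^n_{wg}$: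 $\mathrm{Cat}^1_{wg}=\mathrm{Cat}$. For $n\ge2$: $X_k\in\mathrm{Cat}^{n-1}_{wg}$ for all $k$, $X_0\in\mathrm{Cat}^{n-1}_{hd}$, all Segal maps $X_k\to X_1\times_{X_0}\cdots\times_{X_0}X_1$ are isomorphisms and all induced Segal maps are $(n-1)$-equivalences, defined as above ($k\ge2$), and $p^{(n)}X$ exists and is in $\mathrm{Cat}^{n-1}_{wg}$. * $\mathrm{LTa}^n_{wg}$, $n\ge2$: $\mathrm{LTa}^2_{wg}=\mathrm{Ta}^2_{wg}$. For $n\ge3$, $\mathrm{LTa}^n_{wg}$ is the full subcategory of those $X\in\mathrm{Ta}^n_{wg}$ such that $X_k\in\mathrm{LTa}^{n-1}_{wg}$ for all $k$; the maps $X_k\to X_1\times_{d\bar pX_0}\cdots\times_{d\bar pX_0}X_1$ of $[\Delta^{op\,n-2},\mathrm{Cat}]$ are levelwise equivalences of categories for all $k\ge2$; and $p^{(n)}X\in\mathrm{Cat}^{n-1}_{wg}$. * A *Segalic pseudo-functor* is a pseudo-functor $H:\Delta^{op\,n-1}\to\mathrm{Cat}$ such that $H_{\underline k(0,i)}$ is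 discrete for all $\underline k,i$; the Segal maps $H_{\underline k}\to H_{\underline k(1,i)}\times_{H_{\underline k(0,i)}}\cdots\times_{H_{\underline k(0,i)}}H_{\underline k(1,i)}$ ($k_i$ factors, $k_i\ge2$) are isomorphisms of categories; and $\bar pH$ is the multinerve of an object of $\mathrm{Cat}^{n-1}_{wg}$. Segalic pseudo-functors form a full subcategory $\mathrm{SegPs}[\Delta^{op\,n-1},\mathrm{Cat}]$ of the category of pseudo-functors and pseudo-natural transformations. **Theorem.** Let $n\ge2$. There is a functor $$Tr_n:\mathrm{LTa}^n_{wg}\longrightarrow\mathrm{SegPs}[\Delta^{op\,n-1},\mathrm{Cat}]$$ together with, for each $X\in\mathrm{LTa}^n_{wg}$, a pseudo-natural transformation $t_n(X):Tr_nX\to X$ all of whose components $(Tr_nX)_{\underline k}\to X_{\underline k}$ are equivalences of categories. -/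

import Mathlib

open CategoryTheory Opposite Bicategory

universe u v w

namespace WeaklyGlobular

/-! ### Multi-simplicial index categories -/

/-- The object `[k]` of `Δ^op`. -/
abbrev ord (k : ℕ) : SimplexCategoryᵒᵖ := op (SimplexCategory.mk k)

/-- The set of objects of `Δ^{op m}`, the product of `m` copies of `Δ^op`, built as an iterated
product. -/
def Idx : ℕ → Type
  | 0 => Discrete PUnit
  | m + 1 => SimplexCategoryᵒᵖ × Idx m

/-- The product category `Δ^{op m}`. -/
instance Idx.category : ∀ m : ℕ, Category.{0} (Idx m)
  | 0 => inferInstanceAs (Category (Discrete PUnit))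
  | m + 1 =>
    letI := Idx.category m
    inferInstanceAs (Category (SimplexCategoryᵒᵖ × Idx m))

instance Idx.subsingleton_hom (r s : Idx 0) : Subsingleton (r ⟶ s) :=
  inferInstanceAs (Subsingleton (ULift (PLift _)))

/-- The unique object of `Δ^{op 0}`. -/
def Idx.pt : Idx 0 := Discrete.mk PUnit.unit

theorem Idx.eq_pt (r : Idx 0) : r = Idx.pt :=
  Subsingleton.elim (α := Discrete PUnit) r _

/-- The identification `Δ^op × Δ^{op m} = Δ^{op (m+1)}`; it adds a first coordinate. -/
def Idx.consEquiv (m : ℕ) : (SimplexCategoryᵒᵖ × Idx m) ≌ Idx (m + 1) :=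
  (CategoryTheory.Equivalence.refl : (SimplexCategoryᵒᵖ × Idx m) ≌ (SimplexCategoryᵒᵖ × Idx m))

/-- Splitting off the last coordinate: `Δ^{op (m+1)} ≌ Δ^{op m} × Δ^op`. -/
def Idx.lastEquiv : ∀ m : ℕ, Idx (m + 1) ≌ (Idx m × SimplexCategoryᵒᵖ)
  | 0 => (Idx.consEquiv 0).symm.trans (CategoryTheory.Prod.braiding _ _)
  | m + 1 => (Idx.consEquiv (m + 1)).symm.trans
      ((CategoryTheory.Equivalence.prod
          (CategoryTheory.Equivalence.refl : SimplexCategoryᵒᵖ ≌ SimplexCategoryᵒᵖ)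
          (Idx.lastEquiv m)).trans
        (prod.associativity SimplexCategoryᵒᵖ (Idx m) SimplexCategoryᵒᵖ).symm |>.trans
        (CategoryTheory.Equivalence.prod (Idx.consEquiv m) CategoryTheory.Equivalence.refl))

/-- The functor `Δ^op ⥤ Δ^{op m}`, `[r] ↦ k(r, i)`, which replaces the `i`-th coordinate of `k`
by `[r]` and fixes the other ones. -/
def Idx.dir : ∀ m : ℕ, Idx m → Fin m → (SimplexCategoryᵒᵖ ⥤ Idx m)
  | 0, _, i => i.elim0
  | m + 1, k, i =>
    Fin.cases (motive := fun _ => SimplexCategoryᵒᵖ ⥤ Idx (m + 1))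
      (CategoryTheory.Prod.sectL _ ((Idx.consEquiv m).inverse.obj k).2 ⋙
        (Idx.consEquiv m).functor)
      (fun j => Idx.dir m ((Idx.consEquiv m).inverse.obj k).2 j ⋙
        CategoryTheory.Prod.sectR ((Idx.consEquiv m).inverse.obj k).1 _ ⋙
          (Idx.consEquiv m).functor) i

/-- `[Δ^{op m}, Cat]`. An `n`-fold structure is encoded as an object of this category
with `m = n - 1`. -/
abbrev MCat (m : ℕ) : Type (u + 1) := Idx m ⥤ Cat.{u, u}

/-- An object of `[Δ^{op (m+1)}, Cat]` as a simplicial object in `[Δ^{op m}, Cat]` along the first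
direction. The value at `[k]` is written `X_k`. -/
def simpl (m : ℕ) : MCat.{u} (m + 1) ⥤ SimplicialObject (MCat.{u} m) :=
  (Functor.whiskeringLeft _ _ _).obj (Idx.consEquiv m).functor ⋙ Functor.curry

/-- The object `X_k` of `[Δ^{op m}, Cat]`, for `X` in `[Δ^{op (m+1)}, Cat]`. -/
abbrev level {m : ℕ} (X : MCat.{u} (m + 1)) (k : ℕ) : MCat.{u} m :=
  ((simpl m).obj X).obj (ord k)

/-! ### Segal maps -/

section Segal

variable {C : Type v} [Category.{w} C]

/-- The shape of the zigzag defining `X_1 ×_{X_0} ⋯ ×_{X_0} X_1` with `k + 2` factors. -/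
@[simps]
def segalShape (k : ℕ) : Limits.MulticospanShape where
  L := Fin (k + 2)
  R := Fin (k + 1)
  fst := Fin.castSucc
  snd := Fin.succ

/-- The zigzag whose limit is `X_1 ×_{X_0} ⋯ ×_{X_0} X_1` with `k + 2` factors: the target `δ 0`
of each factor is matched with the source `δ 1` of the next one. -/
def segalIndex (X : SimplicialObject C) (k : ℕ) : Limits.MulticospanIndex (segalShape k) C where
  left _ := X.obj (ord 1)
  right _ := X.obj (ord 0)
  fst _ := X.δ 0
  snd _ := X.δ 1

theorem mkOfSucc_match {k : ℕ} {i j : Fin k} (h : i.val + 1 = j.val) :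
    SimplexCategory.δ (0 : Fin 2) ≫ SimplexCategory.mkOfSucc i =
      SimplexCategory.δ (1 : Fin 2) ≫ SimplexCategory.mkOfSucc j := by
  rw [SimplexCategory.δ_zero_mkOfSucc, SimplexCategory.δ_one_mkOfSucc]
  congr 1
  ext
  simpa using h

/-- The map of `Δ^op` inducing `ν_j : X_k ⟶ X_1`. -/
abbrev spineMap {k : ℕ} (j : Fin k) : ord k ⟶ ord 1 := (SimplexCategory.mkOfSucc j).op

/-- The map of `Δ^op` inducing the source map `d_1 : X_1 ⟶ X_0`. -/
abbrev srcMap : ord 1 ⟶ ord 0 := (SimplexCategory.δ (1 : Fin 2)).op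

/-- The map of `Δ^op` inducing the target map `d_0 : X_1 ⟶ X_0`. -/
abbrev tgtMap : ord 1 ⟶ ord 0 := (SimplexCategory.δ (0 : Fin 2)).op

theorem spineMap_match {k : ℕ} {i j : Fin k} (h : i.val + 1 = j.val) :
    spineMap i ≫ tgtMap = spineMap j ≫ srcMap :=
  congrArg Quiver.Hom.op (mkOfSucc_match h)

/-- The cone over the zigzag given by `X_{k+2}` and the maps `ν_j : X_{k+2} ⟶ X_1`. -/
def segalFork (X : SimplicialObject C) (k : ℕ) : Limits.Multifork (segalIndex X k) :=
  Limits.Multifork.ofι _ (X.obj (ord (k + 2)))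
    (fun j => X.map (spineMap (k := k + 2) j))
    (by
      intro b
      change X.map _ ≫ X.map tgtMap = X.map _ ≫ X.map srcMap
      rw [← X.map_comp, ← X.map_comp]
      exact congrArg (fun g => X.map g)
        (spineMap_match (Fin.val_succ (n := k + 1) b).symm))

/-- All Segal maps `X_k ⟶ X_1 ×_{X_0} ⋯ ×_{X_0} X_1`, `k ≥ 2`, are isomorphisms. -/
def SegalIso (X : SimplicialObject C) : Prop :=
  ∀ k : ℕ, Nonempty (Limits.IsLimit (segalFork X k))

end Segal

/-! ### Fibre products over discrete objects -/

/-- Strings `(x_1, …, x_k)` of objects such that the `t`-value of each entry is the `s`-value of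
the next one. -/
def chain {C : Type v} [Category.{w} C] {S : Type*} (k : ℕ) (s t : C → S) :
    ObjectProperty (Fin k → C) :=
  fun x => ∀ i j : Fin k, i.val + 1 = j.val → t (x i) = s (x j)

theorem functor_ext_of_ι {C : Type*} [Category* C] {D : Type*} [Category* D]
    {P : ObjectProperty D} {F G : C ⥤ P.FullSubcategory} (h : F ⋙ P.ι = G ⋙ P.ι) : F = G := by
  have ho (x : C) : F.obj x = G.obj x :=
    ObjectProperty.FullSubcategory.ext (Functor.congr_obj h x)
  refine CategoryTheory.Functor.ext ho ?_
  intro x y f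
  apply P.ι.map_injective
  rw [Functor.map_comp, Functor.map_comp, eqToHom_map, eqToHom_map]
  exact Functor.congr_hom h f

section Levelwise

variable {J : Type v} [Category.{w} J]

/-- The levelwise full subcategory of `F : J ⥤ Cat` on objects satisfying a property that is stable
under the transition functors. -/
def fullSub (F : J ⥤ Cat.{u, u}) (P : ∀ r, ObjectProperty (F.obj r))
    (hP : ∀ {r s : J} (f : r ⟶ s) (x : F.obj r), P r x → P s ((F.map f).toFunctor.obj x)) :
    J ⥤ Cat.{u, u} where
  obj r := Cat.of (P r).FullSubcategory
  map {r s} f :=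
    ((P s).lift ((P r).ι ⋙ (F.map f).toFunctor) (fun x => hP f x.obj x.property)).toCatHom
  map_id r := by
    apply Cat.ext
    apply functor_ext_of_ι
    change (P r).ι ⋙ (F.map (𝟙 r)).toFunctor = (P r).ι
    rw [F.map_id]
    rfl
  map_comp {r s t} f g := by
    apply Cat.ext
    apply functor_ext_of_ι
    change (P r).ι ⋙ (F.map (f ≫ g)).toFunctor =
      (P r).ι ⋙ (F.map f).toFunctor ⋙ (F.map g).toFunctor
    rw [F.map_comp]
    rfl

/-- The map into a levelwise full subcategory. -/
def fullSubLift {G F : J ⥤ Cat.{u, u}} (α : G ⟶ F) (P : ∀ r, ObjectProperty (F.obj r))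
    (hP : ∀ {r s : J} (f : r ⟶ s) (x : F.obj r), P r x → P s ((F.map f).toFunctor.obj x))
    (hα : ∀ (r : J) (x : G.obj r), P r ((α.app r).toFunctor.obj x)) :
    G ⟶ fullSub F P hP where
  app r := ((P r).lift (α.app r).toFunctor (hα r)).toCatHom
  naturality r s f := by
    apply Cat.ext
    apply functor_ext_of_ι
    exact congrArg Cat.Hom.toFunctor (α.naturality f)

/-- The inclusion of a levelwise full subcategory. -/
def fullSubι (F : J ⥤ Cat.{u, u}) (P : ∀ r, ObjectProperty (F.obj r))
    (hP : ∀ {r s : J} (f : r ⟶ s) (x : F.obj r), P r x → P s ((F.map f).toFunctor.obj x)) :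
    fullSub F P hP ⟶ F where
  app r := ((P r).ι).toCatHom
  naturality _ _ _ := rfl

end Levelwise

/-- The functor `C ↦ C × ⋯ × C` with `k` factors. -/
def power (k : ℕ) : Cat.{u, u} ⥤ Cat.{u, u} where
  obj C := Cat.of (Fin k → C)
  map F := (Functor.pi (fun _ : Fin k => F.toFunctor)).toCatHom

/-! ### Isomorphism classes, connected components, nerves -/

/-- The functor `p : Cat ⥤ Set`, isomorphism classes of objects. -/
abbrev pCat : Cat.{u, u} ⥤ Type u := isomorphismClasses

/-- The functor `q : Cat ⥤ Set`, connected components. -/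
abbrev qCat : Cat.{u, u} ⥤ Type u := Cat.connectedComponents

/-- The canonical map from isomorphism classes to connected components. -/
def pToQ (C : Cat.{u, u}) : pCat.obj C → qCat.obj C :=
  Quotient.lift (s := isIsomorphicSetoid C) (fun x => (Quotient.mk _ x : ConnectedComponents C))
    (by
      rintro x y ⟨e⟩
      exact Quotient.sound (Zigzag.of_hom e.hom))

/-- For a groupoid, isomorphism classes and connected components agree. -/
theorem pToQ_bijective (C : Cat.{u, u}) [IsGroupoid C] : Function.Bijective (pToQ C) := by
  constructor
  · intro x y
    induction x using Quotient.inductionOn with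
    | h x =>
    induction y using Quotient.inductionOn with
    | h y =>
    intro h
    have hz : Zigzag x y := Quotient.exact h
    apply Quotient.sound
    induction hz with
    | refl => exact ⟨Iso.refl _⟩
    | tail _ hz ih =>
      obtain ⟨e⟩ := ih (Quotient.sound ‹_›)
      rcases hz with ⟨⟨f⟩⟩ | ⟨⟨f⟩⟩
      · exact ⟨e ≪≫ asIso f⟩
      · exact ⟨e ≪≫ (asIso f).symm⟩
  · intro y
    induction y using Quotient.inductionOn with
    | h y => exact ⟨Quotient.mk _ y, rfl⟩

/-- `[Δ^{op (m+1)}, Set] ≌ [Δ^{op m}, [Δ^op, Set]]`, currying the last direction. -/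
def lastCurry (m : ℕ) : (Idx (m + 1) ⥤ Type u) ≌ (Idx m ⥤ SSet.{u}) :=
  (Idx.lastEquiv m).congrLeft.trans Functor.currying.symm

/-- The functor `[Δ^{op m}, Cat] ⥤ [Δ^{op (m+1)}, Set]` which takes the nerve levelwise. On `n`-fold
categories it is the multinerve. -/
def multinerve (m : ℕ) : MCat.{u} m ⥤ (Idx (m + 1) ⥤ Type u) :=
  (Functor.whiskeringRight _ _ _).obj nerveFunctor ⋙ (lastCurry m).inverse

/-- The left adjoint of `multinerve`: the left adjoint of the nerve, applied levelwise. -/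
def unnerve (m : ℕ) : (Idx (m + 1) ⥤ Type u) ⥤ MCat.{u} m :=
  (lastCurry m).functor ⋙ (Functor.whiskeringRight _ _ _).obj SSet.hoFunctor

/-- The adjunction between `unnerve` and `multinerve`. -/
noncomputable def unnerveAdj (m : ℕ) : unnerve.{u} m ⊣ multinerve.{u} m :=
  (lastCurry m).toAdjunction.comp (nerveAdjunction.whiskerRight (Idx m))

/-- `p̄ : [Δ^{op m}, Cat] ⥤ [Δ^{op m}, Set]`, the functor `p` applied levelwise. -/
abbrev pBar (m : ℕ) : MCat.{u} m ⥤ (Idx m ⥤ Type u) :=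
  (Functor.whiskeringRight _ _ _).obj pCat

/-- `q̄ : [Δ^{op m}, Cat] ⥤ [Δ^{op m}, Set]`, the functor `q` applied levelwise. -/
abbrev qBar (m : ℕ) : MCat.{u} m ⥤ (Idx m ⥤ Type u) :=
  (Functor.whiskeringRight _ _ _).obj qCat

/-- The truncation functor. If the levelwise set of isomorphism classes of `X` is a
multinerve, `pTrunc m X` is the structure with this multinerve. -/
def pTrunc (m : ℕ) : MCat.{u} (m + 1) ⥤ MCat.{u} m := pBar (m + 1) ⋙ unnerve m

/-- The analogue of `pTrunc` for connected components. -/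
def qTrunc (m : ℕ) : MCat.{u} (m + 1) ⥤ MCat.{u} m := qBar (m + 1) ⋙ unnerve m

/-- The discrete inclusion in the last direction: the multinerve, viewed levelwise as a
discrete category. -/
def discIncl (m : ℕ) : MCat.{u} m ⥤ MCat.{u} (m + 1) :=
  multinerve m ⋙ (Functor.whiskeringRight _ _ _).obj typeToCat

/-- The natural map from `X` to the discrete inclusion of its truncation. -/
noncomputable def truncUnit (m : ℕ) :
    𝟭 (MCat.{u} (m + 1)) ⟶ qTrunc m ⋙ discIncl m :=
  ((Cat.connectedComponentsTypeToCatAdj.whiskerRight (Idx (m + 1))).comp (unnerveAdj m)).unit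

/-- The constant object of `[Δ^{op m}, Cat]` on a discrete category. -/
abbrev constDisc (m : ℕ) : Type u ⥤ MCat.{u} m := typeToCat ⋙ Functor.const (Idx m)

theorem as_obj_eq {S : Type*} {k : ℕ} (x : ComposableArrows (Discrete S) k) (i j : Fin (k + 1)) :
    (x.obj i).as = (x.obj j).as := by
  rcases le_total i j with h | h
  · exact Discrete.eq_of_hom (x.map (homOfLE h))
  · exact (Discrete.eq_of_hom (x.map (homOfLE h))).symm

/-- The discrete inclusion of a constant discrete object is again constant and discrete: a simplex of
the nerve of a discrete category is a constant string. -/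
def discInclConst (m : ℕ) : constDisc.{u} m ⋙ discIncl m ⟶ constDisc.{u} (m + 1) where
  app S :=
    { app r := typeToCat.map (show ((multinerve m).obj ((constDisc m).obj S)).obj r ⟶ S from
        ↾(fun x => ((show ComposableArrows (Discrete S) _ from x).obj 0).as))
      naturality := by
        intro r s f
        change typeToCat.map _ ≫ typeToCat.map _ = typeToCat.map _ ≫ 𝟙 _
        rw [Category.comp_id, ← typeToCat.map_comp]
        apply congrArg
        ext x
        exact as_obj_eq (show ComposableArrows (Discrete S) _ from x) _ _ }
  naturality S T g := by
    apply NatTrans.ext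
    funext r
    change typeToCat.map _ ≫ typeToCat.map _ = typeToCat.map _ ≫ typeToCat.map _
    rw [← typeToCat.map_comp, ← typeToCat.map_comp]
    rfl

/-- The discretization functor `X ↦ X^d`, as a set. It is applied only to homotopically discrete
`X`. The levels of such an `X`, and of all its truncations, are equivalence relations, for which
connected components are the same as isomorphism classes (see `pToQ_bijective`); so this is the
iterated truncation `p^(1) p^(2) ⋯ p^(m+1) X`. -/
def disc : ∀ m : ℕ, MCat.{u} m ⥤ Type u
  | 0 => (evaluation (Idx 0) Cat.{u, u}).obj Idx.pt ⋙ qCat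
  | m + 1 => qTrunc m ⋙ disc m

/-- The discretization map `γ : X ⟶ X^d`, the composite of the maps
`X ⟶ d^(m+1) p^(m+1) X ⟶ d^(m+1) d^(m) p^(m) p^(m+1) X ⟶ ⋯ ⟶ X^d`. -/
noncomputable def discMap : ∀ m : ℕ, 𝟭 (MCat.{u} m) ⟶ disc m ⋙ constDisc m
  | 0 =>
    { app X :=
        { app _ := Cat.connectedComponentsTypeToCatAdj.unit.app (X.obj Idx.pt)
          naturality := by
            intro r s f
            obtain rfl := Idx.eq_pt r
            obtain rfl := Idx.eq_pt s
            obtain rfl := Subsingleton.elim f (𝟙 Idx.pt)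
            have key {A B : Cat.{u, u}} (g : A ⟶ B) : 𝟙 A ≫ g = g ≫ 𝟙 B := by simp
            exact (congrArg (· ≫ _) (X.map_id Idx.pt)).trans (key _) }
      naturality := by
        intro X Y g
        apply NatTrans.ext
        funext r
        exact Cat.connectedComponentsTypeToCatAdj.unit.naturality (g.app Idx.pt) }
  | m + 1 => truncUnit m ≫
      Functor.whiskerLeft (qTrunc m) (Functor.whiskerRight (discMap m) (discIncl m)) ≫
      Functor.whiskerLeft (qTrunc m ⋙ disc m) (discInclConst m)

section Fibre

variable {m : ℕ} {S : Type u}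

/-- The value in `S` of an object of `F_r` under a map `F ⟶ S` to a constant discrete object. -/
def val {F : MCat.{u} m} (α : F ⟶ (constDisc m).obj S) (r : Idx m) (x : F.obj r) : S :=
  (show Discrete S from (α.app r).toFunctor.obj x).as

theorem val_comp {F G : MCat.{u} m} (α : G ⟶ (constDisc m).obj S) (f : F ⟶ G) (r : Idx m)
    (x : F.obj r) : val α r ((f.app r).toFunctor.obj x) = val (f ≫ α) r x := rfl

theorem val_map {F : MCat.{u} m} (α : F ⟶ (constDisc m).obj S) {r s : Idx m} (f : r ⟶ s)
    (x : F.obj r) : val α s ((F.map f).toFunctor.obj x) = val α r x :=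
  congrArg Discrete.as (Functor.congr_obj (congrArg Cat.Hom.toFunctor (α.naturality f)) x)

theorem chain_stable (k : ℕ) {F : MCat.{u} m} (σ τ : F ⟶ (constDisc m).obj S) {r s : Idx m}
    (f : r ⟶ s) (x : (F ⋙ power k).obj r) (hx : chain (C := F.obj r) k (val σ r) (val τ r) x) :
    chain (C := F.obj s) k (val σ s) (val τ s) (((F ⋙ power k).map f).toFunctor.obj x) :=
  fun i j hij => (val_map τ f (x i)).trans ((hx i j hij).trans (val_map σ f (x j)).symm)

theorem fibre_stable {F : MCat.{u} m} (σ τ : F ⟶ (constDisc m).obj S) (a b : S) {r s : Idx m}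
    (f : r ⟶ s) (x : F.obj r) (hx : val σ r x = a ∧ val τ r x = b) :
    val σ s ((F.map f).toFunctor.obj x) = a ∧ val τ s ((F.map f).toFunctor.obj x) = b :=
  ⟨(val_map σ f x).trans hx.1, (val_map τ f x).trans hx.2⟩

/-- The `k`-fold fibre product `F ×_S ⋯ ×_S F` over a constant discrete object, for two maps
`σ, τ : F ⟶ S`; the `τ`-value of each factor is matched with the `σ`-value of the next one. All
morphisms of the levels of `F` are sent to identities, so the fibre product is levelwise a full
subcategory of the product. -/
def fibProd (k : ℕ) {F : MCat.{u} m} (σ τ : F ⟶ (constDisc m).obj S) : MCat.{u} m :=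
  fullSub (F ⋙ power k) (fun r => chain (C := F.obj r) k (val σ r) (val τ r))
    (chain_stable k σ τ)

end Fibre

section InducedSegal

variable {m : ℕ}

/-- The map `X_1 ⟶ X_0 ⟶ X_0^d` given by sources. -/
noncomputable def srcDisc (X : MCat.{u} (m + 1)) :
    level X 1 ⟶ (constDisc m).obj ((disc m).obj (level X 0)) :=
  ((simpl m).obj X).map srcMap ≫ (discMap m).app (level X 0)

/-- The map `X_1 ⟶ X_0 ⟶ X_0^d` given by targets. -/
noncomputable def tgtDisc (X : MCat.{u} (m + 1)) :
    level X 1 ⟶ (constDisc m).obj ((disc m).obj (level X 0)) :=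
  ((simpl m).obj X).map tgtMap ≫ (discMap m).app (level X 0)

/-- The map `(ν_1, …, ν_k) : X_k ⟶ X_1 × ⋯ × X_1`. -/
def spine (X : MCat.{u} (m + 1)) (k : ℕ) : level X k ⟶ level X 1 ⋙ power k where
  app r := (Functor.pi' (fun j : Fin k =>
    ((((simpl m).obj X).map (spineMap j)).app r).toFunctor)).toCatHom
  naturality r s f := by
    apply Cat.ext
    apply Functor.pi_ext
    intro j
    exact congrArg Cat.Hom.toFunctor ((((simpl m).obj X).map (spineMap j)).naturality f)

/-- The `k`-th induced Segal map `X_k ⟶ X_1 ×_{X_0^d} ⋯ ×_{X_0^d} X_1`. -/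
noncomputable def inducedSegal (X : MCat.{u} (m + 1)) (k : ℕ) :
    level X k ⟶ fibProd k (srcDisc X) (tgtDisc X) :=
  fullSubLift (spine X k) (fun r => chain (C := (level X 1).obj r) k (val (srcDisc X) r)
      (val (tgtDisc X) r)) (chain_stable k (srcDisc X) (tgtDisc X)) (by
    intro r x i j hij
    have h : ((simpl m).obj X).map (spineMap i) ≫ tgtDisc X =
        ((simpl m).obj X).map (spineMap j) ≫ srcDisc X := by
      unfold tgtDisc srcDisc
      rw [← Category.assoc, ← Category.assoc, ← Functor.map_comp, ← Functor.map_comp,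
        spineMap_match hij]
    exact congrArg (fun α : level X k ⟶ (constDisc m).obj _ => val α r x) h)

/-- The fibre `X(a, b)` of `X_1 ⟶ X_0^d × X_0^d`. -/
noncomputable def homObj (X : MCat.{u} (m + 1)) (a b : (disc m).obj (level X 0)) : MCat.{u} m :=
  fullSub (level X 1) (fun r x => val (srcDisc X) r x = a ∧ val (tgtDisc X) r x = b)
    (fibre_stable (srcDisc X) (tgtDisc X) a b)

/-- The map `f^d : X_0^d ⟶ Y_0^d`. -/
def objMap {X Y : MCat.{u} (m + 1)} (f : X ⟶ Y) :
    (disc m).obj (level X 0) ⟶ (disc m).obj (level Y 0) :=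
  (disc m).map (((simpl m).map f).app (ord 0))

theorem disc_natural {X Y : MCat.{u} (m + 1)} (f : X ⟶ Y) (g : ord 1 ⟶ ord 0) :
    ((simpl m).map f).app (ord 1) ≫ ((simpl m).obj Y).map g ≫ (discMap m).app (level Y 0) =
      (((simpl m).obj X).map g ≫ (discMap m).app (level X 0)) ≫
        (constDisc m).map (objMap f) := by
  have h := (discMap m).naturality (((simpl m).map f).app (ord 0))
  have h' := ((simpl m).map f).naturality g
  calc _ = (((simpl m).map f).app (ord 1) ≫ ((simpl m).obj Y).map g) ≫
        (discMap m).app (level Y 0) := (Category.assoc _ _ _).symm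
    _ = (((simpl m).obj X).map g ≫ ((simpl m).map f).app (ord 0)) ≫
        (discMap m).app (level Y 0) := congrArg (· ≫ (discMap m).app (level Y 0)) h'.symm
    _ = ((simpl m).obj X).map g ≫ (((simpl m).map f).app (ord 0) ≫
        (discMap m).app (level Y 0)) := Category.assoc _ _ _
    _ = ((simpl m).obj X).map g ≫ ((discMap m).app (level X 0) ≫
        (constDisc m).map (objMap f)) := congrArg (((simpl m).obj X).map g ≫ ·) h
    _ = _ := (Category.assoc _ _ _).symm

theorem val_natural {X Y : MCat.{u} (m + 1)} (f : X ⟶ Y) (g : ord 1 ⟶ ord 0) (r : Idx m)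
    (x : (level X 1).obj r) :
    val (((simpl m).obj Y).map g ≫ (discMap m).app (level Y 0)) r
        (((((simpl m).map f).app (ord 1)).app r).toFunctor.obj x) =
      objMap f (val (((simpl m).obj X).map g ≫ (discMap m).app (level X 0)) r x) :=
  congrArg (fun α : level X 1 ⟶ (constDisc m).obj _ => val α r x) (disc_natural f g)

/-- The map `f(a, b) : X(a, b) ⟶ Y(f a, f b)`. -/
noncomputable def homMap {X Y : MCat.{u} (m + 1)} (f : X ⟶ Y) (a b : (disc m).obj (level X 0)) :
    homObj X a b ⟶ homObj Y (objMap f a) (objMap f b) :=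
  fullSubLift
    (fullSubι (level X 1) (fun r x => val (srcDisc X) r x = a ∧ val (tgtDisc X) r x = b)
      (fibre_stable (srcDisc X) (tgtDisc X) a b) ≫ ((simpl m).map f).app (ord 1))
    (fun r y => val (srcDisc Y) r y = objMap f a ∧ val (tgtDisc Y) r y = objMap f b)
    (fibre_stable (srcDisc Y) (tgtDisc Y) (objMap f a) (objMap f b))
    (fun r x => ⟨(val_natural f srcMap r x.obj).trans (congrArg (objMap f) x.property.1),
      (val_natural f tgtMap r x.obj).trans (congrArg (objMap f) x.property.2)⟩)

end InducedSegal

/-- `(m+1)`-equivalences: for `m = 0` equivalences of categories; otherwise maps `f` such that all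
`f(a, b)` and the truncation of `f` are `m`-equivalences. -/
def IsNEquiv : ∀ (m : ℕ) {X Y : MCat.{u} m}, (X ⟶ Y) → Prop
  | 0, _, _, f => (f.app Idx.pt).toFunctor.IsEquivalence
  | m + 1, X, _, f =>
    (∀ a b : (disc m).obj (level X 0), IsNEquiv m (homMap f a b)) ∧ IsNEquiv m ((pTrunc m).map f)

/-- The `m`-fold simplicial set `Z` is, up to isomorphism, the multinerve of an object with
property `P`. -/
def IsMultinerveOf {m : ℕ} (P : MCat.{u} m → Prop) (Z : Idx (m + 1) ⥤ Type u) : Prop :=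
  ∃ Y : MCat.{u} m, P Y ∧ Nonempty ((multinerve m).obj Y ≅ Z)

/-- Homotopically discrete `(m+1)`-fold categories. -/
def IsHomDisc : ∀ m : ℕ, MCat.{u} m → Prop
  | 0, X => Quiver.IsThin (X.obj Idx.pt) ∧ IsGroupoid (X.obj Idx.pt)
  | m + 1, X =>
    (∀ k : ℕ, IsHomDisc m (level X k)) ∧
    SegalIso ((simpl m).obj X) ∧
    IsMultinerveOf (IsHomDisc m) ((pBar (m + 1)).obj X)

/-- Weakly globular `(m+1)`-fold categories. -/
def IsCatWG : ∀ m : ℕ, MCat.{u} m → Prop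
  | 0, _ => True
  | m + 1, X =>
    (∀ k : ℕ, IsCatWG m (level X k)) ∧
    IsHomDisc m (level X 0) ∧
    SegalIso ((simpl m).obj X) ∧
    (∀ k : ℕ, 2 ≤ k → IsNEquiv m (inducedSegal X k)) ∧
    IsMultinerveOf (IsCatWG m) ((pBar (m + 1)).obj X)

/-- Weakly globular Tamsamani `(m+1)`-categories. -/
def IsTaWG : ∀ m : ℕ, MCat.{u} m → Prop
  | 0, _ => True
  | m + 1, X =>
    (∀ k : ℕ, IsTaWG m (level X k)) ∧
    IsHomDisc m (level X 0) ∧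
    (∀ k : ℕ, 2 ≤ k → IsNEquiv m (inducedSegal X k))

/-- The isomorphism class of an object. -/
def isoClass {C : Cat.{u, u}} (x : C) : pCat.obj C := Quotient.mk (isIsomorphicSetoid C) x

/-- The `r`-level of `v_k : X_k ⟶ X_1 ×_{d p̄ X_0} ⋯ ×_{d p̄ X_0} X_1`, where the target is the
levelwise fibre product over the discrete categories of isomorphism classes of objects of the levels
of `X_0`. For `X_0` homotopically discrete, `d p̄ X_0` is the discrete inclusion of the truncation of
`X_0`. -/
def levelSegal {m : ℕ} (X : MCat.{u} (m + 1)) (k : ℕ) (r : Idx m) :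
    (level X k).obj r ⥤ (chain (C := (level X 1).obj r) k
      (fun x => isoClass (((((simpl m).obj X).map srcMap).app r).toFunctor.obj x))
      (fun x => isoClass (((((simpl m).obj X).map tgtMap).app r).toFunctor.obj x))).FullSubcategory :=
  ObjectProperty.lift _ ((spine X k).app r).toFunctor (by
    intro x i j hij
    have h : ((simpl m).obj X).map (spineMap i) ≫ ((simpl m).obj X).map tgtMap =
        ((simpl m).obj X).map (spineMap j) ≫ ((simpl m).obj X).map srcMap := by
      rw [← Functor.map_comp, ← Functor.map_comp, spineMap_match hij]
    exact congrArg (fun α : level X k ⟶ level X 0 => isoClass ((α.app r).toFunctor.obj x)) h)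

/-- The objects of the category `LTa_wg^n`, `n = m + 2`. -/
def IsLTaWG : ∀ m : ℕ, ObjectProperty (MCat.{u} (m + 1))
  | 0, X => IsTaWG 1 X
  | m + 1, X =>
    IsTaWG (m + 2) X ∧
    (∀ k : ℕ, IsLTaWG m (level X k)) ∧
    (∀ k : ℕ, 2 ≤ k → ∀ r : Idx (m + 1), (levelSegal X k r).IsEquivalence) ∧
    IsMultinerveOf (IsCatWG (m + 1)) ((pBar (m + 2)).obj X)

/-- The category `LTa_wg^n`, `n = m + 2`, a full subcategory of `[Δ^{op (n-1)}, Cat]`. -/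
abbrev LTaWG (m : ℕ) := (IsLTaWG.{u} m).FullSubcategory

/-! ### Segalic pseudo-functors -/

/-- Pseudo-functors `Δ^{op m} → Cat`. -/
abbrev PsFun (m : ℕ) := LocallyDiscrete (Idx m) ⥤ᵖ Cat.{u, u}

section PsCategory

open scoped Pseudofunctor.StrongTrans

theorem strongTrans_ext {m : ℕ} {F G : PsFun.{u} m} {η θ : F.StrongTrans G} (h : η.app = θ.app)
    (h' : HEq (@η.naturality) (@θ.naturality)) : η = θ := by
  cases η
  cases θ
  cases h
  cases h'
  rfl

/-- The category of pseudo-functors and pseudo-natural transformations. -/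
instance psCategory (m : ℕ) : Category (PsFun.{u} m) where
  id_comp {F G} f := by
    refine strongTrans_ext rfl (heq_of_eq ?_)
    funext a b g
    apply Iso.ext
    apply Cat.Hom₂.ext
    apply NatTrans.ext
    funext x
    change 𝟙 _ ≫ (f.app b).toFunctor.map (𝟙 _ ≫ 𝟙 _) ≫ 𝟙 _ ≫
      (f.naturality g).hom.toNatTrans.app x ≫ 𝟙 _ = (f.naturality g).hom.toNatTrans.app x
    rw [Category.comp_id, Category.comp_id, Category.id_comp, Category.id_comp,
      CategoryTheory.Functor.map_id]
    exact Category.id_comp _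
  comp_id {F G} f := by
    refine strongTrans_ext rfl (heq_of_eq ?_)
    funext a b g
    apply Iso.ext
    apply Cat.Hom₂.ext
    apply NatTrans.ext
    funext x
    change 𝟙 _ ≫ (f.naturality g).hom.toNatTrans.app x ≫ 𝟙 _ ≫ (𝟙 _ ≫ 𝟙 _) ≫ 𝟙 _ =
      (f.naturality g).hom.toNatTrans.app x
    simp only [Category.comp_id, Category.id_comp]
  assoc f g h := by
    refine strongTrans_ext rfl (heq_of_eq ?_)
    funext a b k
    apply Iso.ext
    apply Cat.Hom₂.ext
    apply NatTrans.ext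
    funext x
    change 𝟙 _ ≫ (h.app b).toFunctor.map (𝟙 _ ≫ (g.app b).toFunctor.map
        ((f.naturality k).hom.toNatTrans.app x) ≫ 𝟙 _ ≫
          (g.naturality k).hom.toNatTrans.app ((f.app a).toFunctor.obj x) ≫ 𝟙 _) ≫ 𝟙 _ ≫
        (h.naturality k).hom.toNatTrans.app
          ((g.app a).toFunctor.obj ((f.app a).toFunctor.obj x)) ≫ 𝟙 _ =
      𝟙 _ ≫ (h.app b).toFunctor.map ((g.app b).toFunctor.map
        ((f.naturality k).hom.toNatTrans.app x)) ≫ 𝟙 _ ≫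
          (𝟙 _ ≫ (h.app b).toFunctor.map
            ((g.naturality k).hom.toNatTrans.app ((f.app a).toFunctor.obj x)) ≫ 𝟙 _ ≫
              (h.naturality k).hom.toNatTrans.app
                ((g.app a).toFunctor.obj ((f.app a).toFunctor.obj x)) ≫ 𝟙 _) ≫ 𝟙 _
    simp only [Category.comp_id, Category.id_comp, CategoryTheory.Functor.map_comp, Category.assoc]

end PsCategory

section PsFunDefs

variable {m : ℕ} (H : PsFun.{u} m)

/-- The category `H_k`. -/
abbrev psObj (k : Idx m) : Cat.{u, u} := H.obj ⟨k⟩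

/-- The functor `H_k ⥤ H_l` induced by a map of `Δ^{op m}`. -/
abbrev psMap {k l : Idx m} (f : k ⟶ l) : psObj H k ⟶ psObj H l := H.map f.toLoc

theorem pCat_map_eq {C D : Cat.{u, u}} {F G : C ⟶ D} (e : F ≅ G) : pCat.map F = pCat.map G := by
  ext x
  induction x using Quotient.inductionOn with
  | h x => exact Quotient.sound ⟨(Cat.Hom.toNatIso e).app x⟩

/-- The functor `p̄ H : Δ^{op m} ⥤ Set` of isomorphism classes of objects of the levels of `H`. -/
def psBar : Idx m ⥤ Type u where
  obj k := pCat.obj (psObj H k)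
  map f := pCat.map (psMap H f)
  map_id k := (pCat_map_eq (H.mapId ⟨k⟩)).trans (pCat.map_id _)
  map_comp f g := (pCat_map_eq (H.mapComp f.toLoc g.toLoc)).trans (pCat.map_comp _ _)

/-- Discreteness condition: `H_{k(0,i)}` is discrete for all `k` and `i`. -/
def PsDiscrete : Prop :=
  ∀ (k : Idx m) (i : Fin m), IsDiscrete (psObj H ((Idx.dir m k i).obj (ord 0)))

/-- The Segal map `H_{k(r,i)} ⟶ H_{k(1,i)} ×_{H_{k(0,i)}} ⋯ ×_{H_{k(0,i)}} H_{k(1,i)}`. As `H_{k(0,i)}`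
is discrete, the fibre product is a full subcategory of the product. -/
def psSegal (hH : PsDiscrete H) (k : Idx m) (i : Fin m) (r : ℕ) :
    psObj H ((Idx.dir m k i).obj (ord r)) ⟶
      Cat.of (chain (C := psObj H ((Idx.dir m k i).obj (ord 1))) r
        (fun x => (psMap H ((Idx.dir m k i).map srcMap)).toFunctor.obj x)
        (fun x => (psMap H ((Idx.dir m k i).map tgtMap)).toFunctor.obj x)).FullSubcategory :=
  (ObjectProperty.lift _
    (Functor.pi' (fun j : Fin r => (psMap H ((Idx.dir m k i).map (spineMap j))).toFunctor)) (by
      intro x a b hab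
      have := hH k i
      have h : (Idx.dir m k i).map (spineMap a) ≫ (Idx.dir m k i).map tgtMap =
          (Idx.dir m k i).map (spineMap b) ≫ (Idx.dir m k i).map srcMap := by
        rw [← Functor.map_comp, ← Functor.map_comp, spineMap_match hab]
      have e : psMap H ((Idx.dir m k i).map (spineMap a)) ≫ psMap H ((Idx.dir m k i).map tgtMap) ≅
          psMap H ((Idx.dir m k i).map (spineMap b)) ≫ psMap H ((Idx.dir m k i).map srcMap) :=
        (H.mapComp _ _).symm ≪≫ eqToIso (congrArg (fun g => psMap H g) h) ≪≫ H.mapComp _ _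
      exact IsDiscrete.eq_of_hom ((Cat.Hom.toNatIso e).app x).hom)).toCatHom

end PsFunDefs

/-- Segalic pseudo-functors `Δ^{op (m+1)} → Cat`: the discreteness condition, the Segal condition,
and the truncation condition. -/
def IsSegalic (m : ℕ) : ObjectProperty (PsFun.{u} (m + 1)) := fun H =>
  (∃ hH : PsDiscrete H,
    ∀ (k : Idx (m + 1)) (i : Fin (m + 1)) (r : ℕ), 2 ≤ r → IsIso (psSegal H hH k i r)) ∧
  IsMultinerveOf (IsCatWG m) (psBar H)

/-- The category of Segalic pseudo-functors `Δ^{op (m+1)} → Cat`, a full subcategory of the category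
of pseudo-functors. -/
abbrev SegPs (m : ℕ) := (IsSegalic.{u} m).FullSubcategory

end WeaklyGlobular

/-! The proof separates transport of structure from the construction of a good model.

Transport: given categories `M.obj k` equivalent to `X_k`, functors between them, and squares
commuting up to isomorphism with the transition functors of `X`, the `M.obj k` form a pseudo-functor
equivalent to `X`. Restriction along an equivalence is fully faithful on functor categories, so
every constraint is determined by its values on the image of `X_k`. There the squares carry each
coherence law to an identity in the strict diagram `X`.

Model: an object of `LTa_wg` satisfies weak Segal conditions in every direction
(`IsLTaWG.isMultiSegal`). Call a map `k ⟶ (1, …, 1)` a spine if it selects a consecutive edge in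
each direction. Iterating the weak Segal conditions shows that, for `x`, `y` in the same connected
component of `X_k`, the spines identify morphisms `x ⟶ y` with families of morphisms in `X_{1,…,1}`
(`IsMultiSegal.existsUnique`). Hence `X_k` is equivalent to the category `GridObj X k` of
isomorphism classes with a freely chosen representative of their image at each spine. This model is
strict for two reasons. If some coordinate is `[0]` there are no spines, so an object is a bare
isomorphism class and the category is discrete. The spines of `k(r,i)` are the pairs of an edge of
`[r]` and a spine of `k(1,i)`, so representatives at `k(r,i)` are exactly `r`-tuples of
representatives at `k(1,i)`; with the weak Segal condition on classes, the Segal maps become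
bijective on objects. This needs transition functors that merely reindex representatives whenever a
composite is again a spine; elsewhere any functor extending that of `X` will do (`exists_gridProj`).

Truncation: equivalent levels have the same isomorphism classes, so the condition passes from `X` to
the model. For `n ≥ 3` it is part of the definition of `LTa_wg`; for `n = 2` it holds because a
simplicial set with bijective Segal maps is a nerve.

Functoriality: a map `F : X ⟶ Y` acts on models commuting strictly with the comparison functors. The
constraints of the induced transformation are then forced by the squares, so identities and
composites are preserved strictly (`IsCompatible.ext`). -/

namespace WeaklyGlobular

/-! ### Transport of a diagram of categories along levelwise equivalences -/

section Extend

variable {A C D : Type*} [Category* A] [Category* C] [Category* D]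

/-- Two natural transformations agree if they agree on the image of an essentially surjective
functor. -/
theorem natTrans_ext_of_essSurj (g : A ⥤ C) [g.EssSurj] {F G : C ⥤ D} {α β : F ⟶ G}
    (h : ∀ y, α.app (g.obj y) = β.app (g.obj y)) : α = β := by
  ext c
  rw [← cancel_epi (F.map (g.objObjPreimageIso c).hom), α.naturality, β.naturality, h]

/-- An isomorphism between restrictions along an equivalence extends. -/
noncomputable def extendIso (g : A ⥤ C) [g.IsEquivalence] {F G : C ⥤ D} (e : g ⋙ F ≅ g ⋙ G) :
    F ≅ G :=
  ((Functor.whiskeringLeft A C D).obj g).preimageIso e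

theorem extendIso_hom_app (g : A ⥤ C) [g.IsEquivalence] {F G : C ⥤ D} (e : g ⋙ F ≅ g ⋙ G) (y : A) :
    (extendIso g e).hom.app (g.obj y) = e.hom.app y :=
  NatTrans.congr_app (((Functor.whiskeringLeft A C D).obj g).map_preimage e.hom) y

end Extend

variable {J : Type v} [Category.{w} J]

/-- Categories and functors levelwise equivalent to those of a diagram `X`, without any
compatibility between the functors. -/
structure LevelwiseModel (X : J ⥤ Cat.{u, u}) where
  /-- The categories. -/
  obj : J → Cat.{u, u}
  /-- The transition functors. -/
  map {k l : J} (f : k ⟶ l) : obj k ⟶ obj l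
  /-- The comparison functors. -/
  unit (k : J) : X.obj k ⟶ obj k
  equiv (k : J) : (unit k).toFunctor.IsEquivalence
  /-- The comparison functors commute with the transition functors up to isomorphism. -/
  square {k l : J} (f : k ⟶ l) :
    (unit k).toFunctor ⋙ (map f).toFunctor ≅ (X.map f).toFunctor ⋙ (unit l).toFunctor

namespace LevelwiseModel

attribute [instance] LevelwiseModel.equiv

variable {X : J ⥤ Cat.{u, u}} (M : LevelwiseModel X)

/-- The comparison square at an object. -/
def sq {k l : J} (f : k ⟶ l) (y : X.obj k) :
    (M.map f).toFunctor.obj ((M.unit k).toFunctor.obj y) ≅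
      (M.unit l).toFunctor.obj ((X.map f).toFunctor.obj y) :=
  (M.square f).app y

theorem sq_congr {k l : J} {f f' : k ⟶ l} (h : f = f') (y : X.obj k) :
    (M.sq f y).hom = eqToHom (by rw [h]) ≫ (M.sq f' y).hom ≫ eqToHom (by rw [h]) := by
  subst h; simp

theorem obj_map_id (k : J) (y : X.obj k) : (X.map (𝟙 k)).toFunctor.obj y = y := by
  rw [X.map_id]; rfl

theorem obj_map_comp {k l n : J} (f : k ⟶ l) (h : l ⟶ n) (y : X.obj k) :
    (X.map (f ≫ h)).toFunctor.obj y = (X.map h).toFunctor.obj ((X.map f).toFunctor.obj y) := by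
  rw [X.map_comp]; rfl

/-- The unit constraint. -/
noncomputable def idIso (k : J) : (M.map (𝟙 k)).toFunctor ≅ 𝟭 (M.obj k) :=
  extendIso (M.unit k).toFunctor (M.square (𝟙 k) ≪≫
    Functor.isoWhiskerRight (eqToIso (congrArg Cat.Hom.toFunctor (X.map_id k))) _)

theorem idIso_hom_app (k : J) (y : X.obj k) :
    (M.idIso k).hom.app ((M.unit k).toFunctor.obj y) =
      (M.sq (𝟙 k) y).hom ≫ eqToHom (by rw [obj_map_id]; rfl) := by
  refine (extendIso_hom_app _ _ y).trans ?_
  simp [sq, eqToHom_map]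

/-- The composition constraint. -/
noncomputable def compIso {k l n : J} (f : k ⟶ l) (h : l ⟶ n) :
    (M.map (f ≫ h)).toFunctor ≅ (M.map f).toFunctor ⋙ (M.map h).toFunctor :=
  extendIso (M.unit k).toFunctor (M.square (f ≫ h) ≪≫
    Functor.isoWhiskerRight (eqToIso (congrArg Cat.Hom.toFunctor (X.map_comp f h))) _ ≪≫
    Functor.isoWhiskerLeft (X.map f).toFunctor (M.square h).symm ≪≫
    Functor.isoWhiskerRight (M.square f).symm (M.map h).toFunctor)

theorem compIso_hom_app {k l n : J} (f : k ⟶ l) (h : l ⟶ n) (y : X.obj k) :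
    (M.compIso f h).hom.app ((M.unit k).toFunctor.obj y) =
      (M.sq (f ≫ h) y).hom ≫ eqToHom (by rw [obj_map_comp]) ≫
        (M.sq h ((X.map f).toFunctor.obj y)).inv ≫ (M.map h).toFunctor.map (M.sq f y).inv := by
  refine (extendIso_hom_app _ _ y).trans ?_
  simp [sq, eqToHom_map]

/-- The characterisation of the constraint with all inverses moved across, which is the form that
the coherence proofs rewrite with. -/
theorem compIso_hom_app' {k l n : J} (f : k ⟶ l) (h : l ⟶ n) (y : X.obj k) :
    (M.compIso f h).hom.app ((M.unit k).toFunctor.obj y) ≫ (M.map h).toFunctor.map (M.sq f y).hom ≫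
      (M.sq h ((X.map f).toFunctor.obj y)).hom =
      (M.sq (f ≫ h) y).hom ≫ eqToHom (by rw [obj_map_comp]) := by
  rw [compIso_hom_app]
  simp [← Functor.map_comp_assoc]

theorem compIso_naturality {k l n : J} (f : k ⟶ l) (h : l ⟶ n) {x y : M.obj k} (a : x ⟶ y) :
    (M.map (f ≫ h)).toFunctor.map a ≫ (M.compIso f h).hom.app y =
      (M.compIso f h).hom.app x ≫ (M.map h).toFunctor.map ((M.map f).toFunctor.map a) :=
  (M.compIso f h).hom.naturality a

theorem sq_eqToHom {k l : J} (f : k ⟶ l) {y z : X.obj k} (e : y = z) :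
    eqToHom (by rw [e]) ≫ (M.sq f z).hom = (M.sq f y).hom ≫ eqToHom (by rw [e]) := by
  subst e; simp

/-- Followed by the comparison squares of `f`, `g`, `h`, each side collapses to the single square of
the triple composite, because `X` is strictly functorial. -/
theorem comp_assoc_app {a b c d : J} (f : a ⟶ b) (g : b ⟶ c) (h : c ⟶ d) (y : X.obj a) :
    (M.compIso (f ≫ g) h).hom.app ((M.unit a).toFunctor.obj y) ≫
      (M.map h).toFunctor.map ((M.compIso f g).hom.app ((M.unit a).toFunctor.obj y)) =
    eqToHom (by rw [Category.assoc]) ≫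
      (M.compIso f (g ≫ h)).hom.app ((M.unit a).toFunctor.obj y) ≫
      (M.compIso g h).hom.app ((M.map f).toFunctor.obj ((M.unit a).toFunctor.obj y)) := by
  rw [← cancel_mono ((M.map h).toFunctor.map ((M.map g).toFunctor.map (M.sq f y).hom)),
    ← cancel_mono ((M.map h).toFunctor.map (M.sq g ((X.map f).toFunctor.obj y)).hom),
    ← cancel_mono (M.sq h _).hom]
  simp only [Category.assoc]
  have h1 := M.compIso_naturality g h (M.sq f y).hom
  have h2 := M.compIso_hom_app' g h ((X.map f).toFunctor.obj y)
  have h3 := M.compIso_hom_app' f (g ≫ h) y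
  have h4 := M.compIso_hom_app' f g y
  have h5 := M.compIso_hom_app' (f ≫ g) h y
  have h6 := congrArg (M.map h).toFunctor.map h4
  simp only [Functor.map_comp, eqToHom_map] at h6
  rw [← reassoc_of% h1, h2, reassoc_of% h3, reassoc_of% h6,
    M.sq_eqToHom h (obj_map_comp f g y), reassoc_of% h5, M.sq_congr (Category.assoc f g h) y]
  simp

theorem id_comp_app {k l : J} (f : k ⟶ l) (y : X.obj k) :
    (M.compIso (𝟙 k) f).hom.app ((M.unit k).toFunctor.obj y) ≫
      (M.map f).toFunctor.map ((M.idIso k).hom.app ((M.unit k).toFunctor.obj y)) =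
    eqToHom (by rw [Category.id_comp]; rfl) := by
  rw [← cancel_mono (M.sq f y).hom, idIso_hom_app, Category.assoc, Functor.map_comp, eqToHom_map,
    Category.assoc, M.sq_eqToHom f (obj_map_id k y), reassoc_of% M.compIso_hom_app' (𝟙 k) f y,
    M.sq_congr (Category.id_comp f) y]
  simp

theorem comp_id_app {k l : J} (f : k ⟶ l) (y : X.obj k) :
    (M.compIso f (𝟙 l)).hom.app ((M.unit k).toFunctor.obj y) ≫
      (M.idIso l).hom.app ((M.map f).toFunctor.obj ((M.unit k).toFunctor.obj y)) =
    eqToHom (by rw [Category.comp_id]; rfl) := by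
  have h1 : (M.map (𝟙 l)).toFunctor.map (M.sq f y).hom ≫ (M.idIso l).hom.app _ =
      (M.idIso l).hom.app _ ≫ (M.sq f y).hom := (M.idIso l).hom.naturality (M.sq f y).hom
  rw [← cancel_mono (M.sq f y).hom, Category.assoc, ← h1, idIso_hom_app,
    reassoc_of% M.compIso_hom_app' f (𝟙 l) y, M.sq_congr (Category.comp_id f) y]
  simp

/-- The pseudo-functor structure on a levelwise model. -/
noncomputable def pseudofunctor : LocallyDiscrete J ⥤ᵖ Cat.{u, u} :=
  LocallyDiscrete.mkPseudofunctor M.obj M.map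
    (fun k => Cat.Hom.isoMk (M.idIso k)) (fun f h => Cat.Hom.isoMk (M.compIso f h))
    (by
      intro a b c d f g h
      apply Cat.Hom₂.ext
      refine natTrans_ext_of_essSurj (M.unit a).toFunctor fun y => ?_
      rw [Cat.eqToHom_app]
      -- The `𝟙 _` is the component of the associator of `Cat`.
      change (M.compIso (f ≫ g) h).hom.app ((M.unit a).toFunctor.obj y) ≫
        (M.map h).toFunctor.map ((M.compIso f g).hom.app ((M.unit a).toFunctor.obj y)) ≫ 𝟙 _ ≫
        (M.compIso g h).inv.app ((M.map f).toFunctor.obj ((M.unit a).toFunctor.obj y)) ≫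
        (M.compIso f (g ≫ h)).inv.app ((M.unit a).toFunctor.obj y) = _
      rw [reassoc_of% M.comp_assoc_app f g h y]
      simp)
    (by
      intro a b f
      apply Cat.Hom₂.ext
      refine natTrans_ext_of_essSurj (M.unit a).toFunctor fun y => ?_
      rw [Cat.eqToHom_app]
      refine Eq.trans ?_ (M.id_comp_app f y)
      change (M.compIso (𝟙 a) f).hom.app ((M.unit a).toFunctor.obj y) ≫
        (M.map f).toFunctor.map ((M.idIso a).hom.app ((M.unit a).toFunctor.obj y)) ≫ 𝟙 _ = _
      rw [Category.comp_id])
    (by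
      intro a b f
      apply Cat.Hom₂.ext
      refine natTrans_ext_of_essSurj (M.unit a).toFunctor fun y => ?_
      rw [Cat.eqToHom_app]
      refine Eq.trans ?_ (M.comp_id_app f y)
      change (M.compIso f (𝟙 b)).hom.app ((M.unit a).toFunctor.obj y) ≫
        (M.idIso b).hom.app ((M.map f).toFunctor.obj ((M.unit a).toFunctor.obj y)) ≫ 𝟙 _ = _
      exact congrArg (_ ≫ ·) (Category.comp_id _))

/-! ### The equivalence from the transported pseudo-functor back to the diagram. -/

/-- The inverse of the comparison functor. -/
noncomputable abbrev counit (k : J) : M.obj k ⟶ X.obj k := (M.unit k).toFunctor.inv.toCatHom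

/-- The inverse comparison functors commute with the transition functors up to isomorphism. -/
noncomputable def counitSquare {k l : J} (f : k ⟶ l) :
    (M.map f).toFunctor ⋙ (M.unit l).toFunctor.inv ≅
      (M.unit k).toFunctor.inv ⋙ (X.map f).toFunctor :=
  extendIso (M.unit k).toFunctor
    (Functor.isoWhiskerRight (M.square f) (M.unit l).toFunctor.inv ≪≫
    Functor.isoWhiskerLeft (X.map f).toFunctor (M.unit l).toFunctor.asEquivalence.unitIso.symm ≪≫
    Functor.isoWhiskerRight (M.unit k).toFunctor.asEquivalence.unitIso (X.map f).toFunctor)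

/-- The comparison functors are inverse up to isomorphism. -/
noncomputable def unitInv (k : J) (y : X.obj k) :
    (M.unit k).toFunctor.inv.obj ((M.unit k).toFunctor.obj y) ≅ y :=
  ((M.unit k).toFunctor.asEquivalence.unitIso.app y).symm

theorem counitSquare_hom_app {k l : J} (f : k ⟶ l) (y : X.obj k) :
    (M.counitSquare f).hom.app ((M.unit k).toFunctor.obj y) =
      (M.unit l).toFunctor.inv.map (M.sq f y).hom ≫ (M.unitInv l _).hom ≫
        (X.map f).toFunctor.map (M.unitInv k y).inv := by
  exact extendIso_hom_app _ _ y

theorem counitSquare_naturality {k l : J} (f : k ⟶ l) {x y : M.obj k} (a : x ⟶ y) :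
    (M.unit l).toFunctor.inv.map ((M.map f).toFunctor.map a) ≫ (M.counitSquare f).hom.app y =
      (M.counitSquare f).hom.app x ≫
        (X.map f).toFunctor.map ((M.unit k).toFunctor.inv.map a) :=
  (M.counitSquare f).hom.naturality a

theorem map_id_map {k : J} {y z : X.obj k} (a : y ⟶ z) :
    (X.map (𝟙 k)).toFunctor.map a ≫ eqToHom (obj_map_id k z) = eqToHom (obj_map_id k y) ≫ a := by
  rw [Functor.congr_hom (congrArg Cat.Hom.toFunctor (X.map_id k)) a]
  simp

theorem map_comp_map {k l n : J} (f : k ⟶ l) (h : l ⟶ n) {y z : X.obj k} (a : y ⟶ z) :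
    (X.map (f ≫ h)).toFunctor.map a ≫ eqToHom (obj_map_comp f h z) =
      eqToHom (obj_map_comp f h y) ≫ (X.map h).toFunctor.map ((X.map f).toFunctor.map a) := by
  rw [Functor.congr_hom (congrArg Cat.Hom.toFunctor (X.map_comp f h)) a]
  simp

theorem unitInv_eqToHom {k : J} {y z : X.obj k} (e : y = z) :
    (M.unitInv k y).hom ≫ eqToHom e = eqToHom (by rw [e]) ≫ (M.unitInv k z).hom := by
  subst e; simp

theorem counitSquare_id (k : J) (y : X.obj k) :
    (M.counitSquare (𝟙 k)).hom.app ((M.unit k).toFunctor.obj y) ≫ eqToHom (obj_map_id k _) =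
      (M.unit k).toFunctor.inv.map ((M.idIso k).hom.app ((M.unit k).toFunctor.obj y)) := by
  rw [counitSquare_hom_app, Category.assoc, Category.assoc, map_id_map,
    reassoc_of% M.unitInv_eqToHom (obj_map_id k y), Iso.hom_inv_id, idIso_hom_app,
    Functor.map_comp, eqToHom_map, Category.comp_id]

theorem counitSquare_comp {k l n : J} (f : k ⟶ l) (h : l ⟶ n) (y : X.obj k) :
    (M.counitSquare (f ≫ h)).hom.app ((M.unit k).toFunctor.obj y) ≫ eqToHom (obj_map_comp f h _) =
      (M.unit n).toFunctor.inv.map ((M.compIso f h).hom.app ((M.unit k).toFunctor.obj y)) ≫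
      (M.counitSquare h).hom.app ((M.map f).toFunctor.obj ((M.unit k).toFunctor.obj y)) ≫
      (X.map h).toFunctor.map ((M.counitSquare f).hom.app ((M.unit k).toFunctor.obj y)) := by
  have h1 := congrArg (M.unit n).toFunctor.inv.map (M.compIso_hom_app' f h y)
  simp only [Functor.map_comp, eqToHom_map] at h1
  rw [counitSquare_hom_app, counitSquare_hom_app, Category.assoc, Category.assoc, map_comp_map,
    reassoc_of% M.unitInv_eqToHom (obj_map_comp f h y),
    Functor.map_comp (X.map h).toFunctor, Functor.map_comp (X.map h).toFunctor,
    ← reassoc_of% M.counitSquare_naturality h (M.sq f y).hom, counitSquare_hom_app,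
    Category.assoc, Category.assoc, ← Functor.map_comp_assoc (X.map h).toFunctor,
    Iso.inv_hom_id, CategoryTheory.Functor.map_id, Category.id_comp, reassoc_of% h1]

theorem toPseudofunctor_mapId_app (k : J) (y : X.obj k) :
    (X.toPseudofunctor'.mapId ⟨k⟩).hom.toNatTrans.app y = eqToHom (obj_map_id k y) :=
  Cat.eqToHom_app _ _ (X.map_id k) y

theorem toPseudofunctor_mapComp_app {k l n : J} (f : k ⟶ l) (h : l ⟶ n) (y : X.obj k) :
    (X.toPseudofunctor'.mapComp f.toLoc h.toLoc).hom.toNatTrans.app y =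
      eqToHom (obj_map_comp f h y) :=
  Cat.eqToHom_app _ _ (X.map_comp f h) y

/-- The only 2-cells of a locally discrete bicategory are identities. -/
theorem naturality_naturality_of_locallyDiscrete {F G : LocallyDiscrete J ⥤ᵖ Cat.{u, u}}
    (app : ∀ a, F.obj a ⟶ G.obj a)
    (nat : ∀ {a b : LocallyDiscrete J} (f : a ⟶ b), F.map f ≫ app b ≅ app a ≫ G.map f)
    {a b : LocallyDiscrete J} {f g : a ⟶ b} (η : f ⟶ g) :
    F.map₂ η ▷ app b ≫ (nat g).hom = (nat f).hom ≫ app a ◁ G.map₂ η := by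
  obtain rfl := obj_ext_of_isDiscrete η
  obtain rfl := Subsingleton.elim η (𝟙 _)
  rw [PrelaxFunctor.map₂_id, PrelaxFunctor.map₂_id, id_whiskerRight, whiskerLeft_id,
    Category.id_comp, Category.comp_id]

/-- The identities stand for associators of `Cat`, which have identity components. -/
theorem comp_id_comp_id_comp_id {C : Type*} [Category* C] {x y z t : C} (a : x ⟶ y) (b : y ⟶ z)
    (c : z ⟶ t) : a ≫ 𝟙 _ ≫ b ≫ 𝟙 _ ≫ c ≫ 𝟙 _ = a ≫ b ≫ c := by simp

/-- The pseudo-natural equivalence from the transported pseudo-functor to the diagram. -/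
noncomputable def counitTrans : Pseudofunctor.StrongTrans M.pseudofunctor X.toPseudofunctor' where
  app k := M.counit k.as
  naturality f := Cat.Hom.isoMk (M.counitSquare f.as)
  naturality_naturality η :=
    naturality_naturality_of_locallyDiscrete (F := M.pseudofunctor) (G := X.toPseudofunctor')
      (fun k => M.counit k.as) (fun f => Cat.Hom.isoMk (M.counitSquare f.as)) η
  naturality_id a := by
    apply Cat.Hom₂.ext
    refine natTrans_ext_of_essSurj (M.unit a.as).toFunctor fun y => ?_
    refine Eq.trans ?_ ((M.counitSquare_id a.as y).trans ?_)
    · exact congrArg (_ ≫ ·) (toPseudofunctor_mapId_app a.as _)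
    · exact ((congrArg (_ ≫ ·) (Category.comp_id (𝟙 _))).trans (Category.comp_id _)).symm
  naturality_comp {a b c} f h := by
    apply Cat.Hom₂.ext
    refine natTrans_ext_of_essSurj (M.unit a.as).toFunctor fun y => ?_
    refine Eq.trans ?_ ((M.counitSquare_comp f.as h.as y).trans ?_)
    · exact congrArg (_ ≫ ·) (toPseudofunctor_mapComp_app f.as h.as _)
    · exact (comp_id_comp_id_comp_id _ _ _).symm

end LevelwiseModel

end WeaklyGlobular

namespace WeaklyGlobular

namespace LevelwiseModel

variable {J : Type v} [Category.{w} J]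

/-! ### Pseudo-natural transformations between transported pseudo-functors. -/

section Hom

variable {X Y : J ⥤ Cat.{u, u}} {M : LevelwiseModel X} {N : LevelwiseModel Y} {F : X ⟶ Y}

theorem comm_obj {T : ∀ k, M.obj k ⟶ N.obj k} (hT : ∀ k, M.unit k ≫ T k = F.app k ≫ N.unit k)
    (k : J) (y : X.obj k) : (T k).toFunctor.obj ((M.unit k).toFunctor.obj y) =
      (N.unit k).toFunctor.obj ((F.app k).toFunctor.obj y) :=
  Functor.congr_obj (congrArg Cat.Hom.toFunctor (hT k)) y

theorem natTrans_obj (F : X ⟶ Y) {k l : J} (f : k ⟶ l) (y : X.obj k) :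
    (F.app l).toFunctor.obj ((X.map f).toFunctor.obj y) =
      (Y.map f).toFunctor.obj ((F.app k).toFunctor.obj y) :=
  Functor.congr_obj (congrArg Cat.Hom.toFunctor (F.naturality f)) y

theorem comm_obj_map {T : ∀ k, M.obj k ⟶ N.obj k}
    (hT : ∀ k, M.unit k ≫ T k = F.app k ≫ N.unit k) {k l : J} (f : k ⟶ l) (y : X.obj k) :
    (T l).toFunctor.obj ((M.unit l).toFunctor.obj ((X.map f).toFunctor.obj y)) =
      (N.unit l).toFunctor.obj ((Y.map f).toFunctor.obj ((F.app k).toFunctor.obj y)) := by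
  rw [comm_obj hT, natTrans_obj]

/-- The naturality constraint of functors which commute strictly with the comparison functors. -/
noncomputable def homSquare (T : ∀ k, M.obj k ⟶ N.obj k)
    (hT : ∀ k, M.unit k ≫ T k = F.app k ≫ N.unit k) {k l : J} (f : k ⟶ l) :
    (M.map f).toFunctor ⋙ (T l).toFunctor ≅ (T k).toFunctor ⋙ (N.map f).toFunctor :=
  extendIso (M.unit k).toFunctor
    (Functor.isoWhiskerRight (M.square f) (T l).toFunctor ≪≫
      Functor.isoWhiskerLeft (X.map f).toFunctor
        (eqToIso (congrArg Cat.Hom.toFunctor (hT l)) :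
          (M.unit l).toFunctor ⋙ (T l).toFunctor ≅ (F.app l).toFunctor ⋙ (N.unit l).toFunctor) ≪≫
      Functor.isoWhiskerRight (eqToIso (congrArg Cat.Hom.toFunctor (F.naturality f)) :
          (X.map f).toFunctor ⋙ (F.app l).toFunctor ≅ (F.app k).toFunctor ⋙ (Y.map f).toFunctor)
        (N.unit l).toFunctor ≪≫
      Functor.isoWhiskerLeft (F.app k).toFunctor (N.square f).symm ≪≫
      Functor.isoWhiskerRight (eqToIso (congrArg Cat.Hom.toFunctor (hT k)).symm :
          (F.app k).toFunctor ⋙ (N.unit k).toFunctor ≅ (M.unit k).toFunctor ⋙ (T k).toFunctor)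
        (N.map f).toFunctor)

variable (T : ∀ k, M.obj k ⟶ N.obj k) (hT : ∀ k, M.unit k ≫ T k = F.app k ≫ N.unit k)

/-- This equation determines the constraint, since the square of `N` is invertible; it is the second
clause of `IsCompatible`. -/
theorem homSquare_app {k l : J} (f : k ⟶ l) (y : X.obj k) :
    (homSquare T hT f).hom.app ((M.unit k).toFunctor.obj y) ≫
      (N.map f).toFunctor.map (eqToHom (comm_obj hT k y)) ≫
        (N.sq f ((F.app k).toFunctor.obj y)).hom =
      (T l).toFunctor.map (M.sq f y).hom ≫ eqToHom (comm_obj_map hT f y) := by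
  rw [homSquare, extendIso_hom_app]
  simp [sq, eqToHom_map]

theorem homSquare_naturality {k l : J} (f : k ⟶ l) {x y : M.obj k} (a : x ⟶ y) :
    (T l).toFunctor.map ((M.map f).toFunctor.map a) ≫ (homSquare T hT f).hom.app y =
      (homSquare T hT f).hom.app x ≫ (N.map f).toFunctor.map ((T k).toFunctor.map a) :=
  (homSquare T hT f).hom.naturality a

theorem homSquare_id (k : J) (y : X.obj k) :
    (homSquare T hT (𝟙 k)).hom.app ((M.unit k).toFunctor.obj y) ≫
      (N.idIso k).hom.app ((T k).toFunctor.obj ((M.unit k).toFunctor.obj y)) =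
      (T k).toFunctor.map ((M.idIso k).hom.app ((M.unit k).toFunctor.obj y)) := by
  have h1 : (N.map (𝟙 k)).toFunctor.map (eqToHom (comm_obj hT k y)) ≫ (N.idIso k).hom.app _ =
      (N.idIso k).hom.app _ ≫ eqToHom (comm_obj hT k y) :=
    (N.idIso k).hom.naturality _
  rw [← cancel_mono (eqToHom (comm_obj hT k y)), Category.assoc, ← h1, idIso_hom_app,
    reassoc_of% homSquare_app T hT (𝟙 k) y, idIso_hom_app, Functor.map_comp, eqToHom_map]
  simp

theorem homSquare_comp {k l n : J} (f : k ⟶ l) (h : l ⟶ n) (y : X.obj k) :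
    (homSquare T hT (f ≫ h)).hom.app ((M.unit k).toFunctor.obj y) ≫
      (N.compIso f h).hom.app ((T k).toFunctor.obj ((M.unit k).toFunctor.obj y)) =
      (T n).toFunctor.map ((M.compIso f h).hom.app ((M.unit k).toFunctor.obj y)) ≫
      (homSquare T hT h).hom.app ((M.map f).toFunctor.obj ((M.unit k).toFunctor.obj y)) ≫
      (N.map h).toFunctor.map ((homSquare T hT f).hom.app ((M.unit k).toFunctor.obj y)) := by
  have h1 := congrArg (T n).toFunctor.map (M.compIso_hom_app' f h y)
  have h2 := congrArg (N.map h).toFunctor.map (homSquare_app T hT f y)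
  have h3 := homSquare_app T hT h ((X.map f).toFunctor.obj y)
  have h4 : eqToHom (by rw [comm_obj_map hT]) ≫
        (N.sq h ((Y.map f).toFunctor.obj ((F.app k).toFunctor.obj y))).hom =
      (N.map h).toFunctor.map (eqToHom (comm_obj hT l ((X.map f).toFunctor.obj y))) ≫
        (N.sq h _).hom ≫ eqToHom (by rw [natTrans_obj F]) := by
    rw [← N.sq_eqToHom h (natTrans_obj F f y), eqToHom_map, eqToHom_trans_assoc]
  simp only [Functor.map_comp, eqToHom_map] at h1 h2
  rw [← cancel_mono ((N.map h).toFunctor.map ((N.map f).toFunctor.map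
      (eqToHom (comm_obj hT k y)))),
    ← cancel_mono ((N.map h).toFunctor.map (N.sq f ((F.app k).toFunctor.obj y)).hom),
    ← cancel_mono (N.sq h _).hom]
  simp only [Category.assoc]
  rw [← reassoc_of% N.compIso_naturality f h (eqToHom (comm_obj hT k y)), compIso_hom_app',
    reassoc_of% homSquare_app T hT (f ≫ h) y, eqToHom_map, eqToHom_map, reassoc_of% h2,
    ← reassoc_of% homSquare_naturality T hT h (M.sq f y).hom, h4, reassoc_of% h3, reassoc_of% h1]
  simp

/-- The pseudo-natural transformation given by functors which commute strictly with the comparison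
functors. -/
noncomputable def homTrans : Pseudofunctor.StrongTrans M.pseudofunctor N.pseudofunctor where
  app k := T k.as
  naturality f := Cat.Hom.isoMk (homSquare T hT f.as)
  naturality_naturality η :=
    naturality_naturality_of_locallyDiscrete (F := M.pseudofunctor) (G := N.pseudofunctor)
      (fun k => T k.as) (fun f => Cat.Hom.isoMk (homSquare T hT f.as)) η
  naturality_id a := by
    apply Cat.Hom₂.ext
    refine natTrans_ext_of_essSurj (M.unit a.as).toFunctor fun y => ?_
    refine (homSquare_id T hT a.as y).trans ?_
    exact ((congrArg (_ ≫ ·) (Category.comp_id (𝟙 _))).trans (Category.comp_id _)).symm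
  naturality_comp {a b c} f h := by
    apply Cat.Hom₂.ext
    refine natTrans_ext_of_essSurj (M.unit a.as).toFunctor fun y => ?_
    refine (homSquare_comp T hT f.as h.as y).trans ?_
    exact (comp_id_comp_id_comp_id _ _ _).symm

/-- A pseudo-natural transformation is compatible with a natural transformation of diagrams if it
commutes strictly with the comparison functors, and its constraints are those forced by the
comparison squares. -/
def IsCompatible (F : X ⟶ Y) (η : Pseudofunctor.StrongTrans M.pseudofunctor N.pseudofunctor) :
    Prop :=
  ∃ h : ∀ k, M.unit k ≫ η.app ⟨k⟩ = F.app k ≫ N.unit k,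
    ∀ {k l : J} (f : k ⟶ l) (y : X.obj k),
      (η.naturality f.toLoc).hom.toNatTrans.app ((M.unit k).toFunctor.obj y) ≫
        (N.map f).toFunctor.map (eqToHom (comm_obj h k y)) ≫
          (N.sq f ((F.app k).toFunctor.obj y)).hom =
        (η.app ⟨l⟩).toFunctor.map (M.sq f y).hom ≫ eqToHom (comm_obj_map h f y)

theorem homTrans_isCompatible : IsCompatible F (homTrans T hT) :=
  ⟨hT, fun f y => homSquare_app T hT f y⟩

/-- Compatibility fixes the constraints on the image of the comparison functor, which is essentially
surjective. Equalities of transformations thus reduce to equalities of component functors. -/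
theorem IsCompatible.ext {η θ : Pseudofunctor.StrongTrans M.pseudofunctor N.pseudofunctor}
    (hη : IsCompatible F η) (hθ : IsCompatible F θ) (h : η.app = θ.app) : η = θ := by
  obtain ⟨a, n, p, q, r⟩ := η
  obtain ⟨a', n', p', q', r'⟩ := θ
  obtain rfl : a = a' := h
  obtain ⟨c, hc⟩ := hη
  obtain ⟨c', hc'⟩ := hθ
  have : @n = @n' := by
    funext k l f
    apply Iso.ext
    apply Cat.Hom₂.ext
    refine natTrans_ext_of_essSurj (M.unit k.as).toFunctor fun y => ?_
    have e := (hc f.as y).trans (hc' f.as y).symm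
    exact (cancel_mono ((N.map f.as).toFunctor.map (eqToHom (comm_obj c k.as y)) ≫
      (N.sq f.as ((F.app k.as).toFunctor.obj y)).hom)).1 e
  subst this
  rfl

end Hom

/-! ### Compatible transformations contain identities and are closed under composition. -/

section Category

variable {m : ℕ} {X Y Z : Idx m ⥤ Cat.{u, u}} {M : LevelwiseModel X} {N : LevelwiseModel Y}
  {P : LevelwiseModel Z}

theorem isCompatible_id (M : LevelwiseModel X) :
    IsCompatible (𝟙 X) (𝟙 (show PsFun.{u} m from M.pseudofunctor)) := by
  refine ⟨fun k => rfl, fun {k l} f y => ?_⟩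
  have key {C D : Cat.{u, u}} (G : C ⥤ D) (x : C) {z : D} (s : G.obj x ⟶ z) :
      (𝟙 (G.obj x) ≫ 𝟙 (G.obj x)) ≫ G.map (𝟙 x) ≫ s = s ≫ 𝟙 z := by simp
  exact key _ _ _

theorem comm_comp {F : X ⟶ Y} {G : Y ⟶ Z} {T : ∀ k, M.obj k ⟶ N.obj k}
    (hT : ∀ k, M.unit k ≫ T k = F.app k ≫ N.unit k) {U : ∀ k, N.obj k ⟶ P.obj k}
    (hU : ∀ k, N.unit k ≫ U k = G.app k ≫ P.unit k) (k : Idx m) :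
    M.unit k ≫ T k ≫ U k = (F ≫ G).app k ≫ P.unit k := by
  rw [← Category.assoc, hT k, Category.assoc, hU k, NatTrans.comp_app, Category.assoc]

/-- Pasting of the two compatibility equations along the naturality of `β`. The constraints are
plain natural transformations here, so that the rewriting does not meet composites in the
bicategory. -/
theorem constraint_comp {F : X ⟶ Y} {G : Y ⟶ Z} {T : ∀ k, M.obj k ⟶ N.obj k}
    (hT : ∀ k, M.unit k ≫ T k = F.app k ≫ N.unit k) {U : ∀ k, N.obj k ⟶ P.obj k}
    (hU : ∀ k, N.unit k ≫ U k = G.app k ≫ P.unit k) {k l : Idx m} (f : k ⟶ l)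
    (α : (M.map f).toFunctor ⋙ (T l).toFunctor ⟶ (T k).toFunctor ⋙ (N.map f).toFunctor)
    (β : (N.map f).toFunctor ⋙ (U l).toFunctor ⟶ (U k).toFunctor ⋙ (P.map f).toFunctor)
    (y : X.obj k)
    (hα : α.app ((M.unit k).toFunctor.obj y) ≫
        (N.map f).toFunctor.map (eqToHom (comm_obj hT k y)) ≫
          (N.sq f ((F.app k).toFunctor.obj y)).hom =
        (T l).toFunctor.map (M.sq f y).hom ≫ eqToHom (comm_obj_map hT f y))
    (hβ : β.app ((N.unit k).toFunctor.obj ((F.app k).toFunctor.obj y)) ≫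
        (P.map f).toFunctor.map (eqToHom (comm_obj hU k ((F.app k).toFunctor.obj y))) ≫
          (P.sq f ((G.app k).toFunctor.obj ((F.app k).toFunctor.obj y))).hom =
        (U l).toFunctor.map (N.sq f ((F.app k).toFunctor.obj y)).hom ≫
          eqToHom (comm_obj_map hU f ((F.app k).toFunctor.obj y)))
    (p : (U k).toFunctor.obj ((T k).toFunctor.obj ((M.unit k).toFunctor.obj y)) =
      (P.unit k).toFunctor.obj ((G.app k).toFunctor.obj ((F.app k).toFunctor.obj y)))
    (q : (U l).toFunctor.obj ((T l).toFunctor.obj ((M.unit l).toFunctor.obj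
        ((X.map f).toFunctor.obj y))) = (P.unit l).toFunctor.obj
          ((Z.map f).toFunctor.obj ((G.app k).toFunctor.obj ((F.app k).toFunctor.obj y)))) :
    (U l).toFunctor.map (α.app ((M.unit k).toFunctor.obj y)) ≫
      β.app ((T k).toFunctor.obj ((M.unit k).toFunctor.obj y)) ≫
      (P.map f).toFunctor.map (eqToHom p) ≫
        (P.sq f ((G.app k).toFunctor.obj ((F.app k).toFunctor.obj y))).hom =
      (U l).toFunctor.map ((T l).toFunctor.map (M.sq f y).hom) ≫
        eqToHom q := by
  have h1 := congrArg (U l).toFunctor.map hα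
  have h3 : (U l).toFunctor.map ((N.map f).toFunctor.map (eqToHom (comm_obj hT k y))) ≫
      β.app ((N.unit k).toFunctor.obj ((F.app k).toFunctor.obj y)) =
      β.app ((T k).toFunctor.obj ((M.unit k).toFunctor.obj y)) ≫
        (P.map f).toFunctor.map ((U k).toFunctor.map (eqToHom (comm_obj hT k y))) :=
    β.naturality _
  have e : (P.map f).toFunctor.map (eqToHom p) =
      (P.map f).toFunctor.map ((U k).toFunctor.map (eqToHom (comm_obj hT k y))) ≫
        (P.map f).toFunctor.map (eqToHom (comm_obj hU k ((F.app k).toFunctor.obj y))) := by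
    simp only [eqToHom_map, eqToHom_trans]
  simp only [Functor.map_comp] at h1
  rw [e]
  simp only [Category.assoc]
  rw [← reassoc_of% h3, hβ, reassoc_of% h1, eqToHom_map, eqToHom_trans]

theorem IsCompatible.comp {F : X ⟶ Y} {G : Y ⟶ Z}
    {η : (show PsFun.{u} m from M.pseudofunctor) ⟶ N.pseudofunctor}
    {θ : (show PsFun.{u} m from N.pseudofunctor) ⟶ P.pseudofunctor}
    (hη : IsCompatible F η) (hθ : IsCompatible G θ) : IsCompatible (F ≫ G) (η ≫ θ) := by
  obtain ⟨c, hc⟩ := hη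
  obtain ⟨d, hd⟩ := hθ
  refine ⟨comm_comp (T := fun k => η.app ⟨k⟩) (U := fun k => θ.app ⟨k⟩) c d,
    fun {k l} f y => ?_⟩
  -- The three identities are the associators in the constraint of a composite transformation.
  have key {C : Cat.{u, u}} {a b c d : C} (p : a ⟶ b) (q : b ⟶ c) (r : c ⟶ d) :
      (𝟙 a ≫ p ≫ 𝟙 b ≫ q ≫ 𝟙 c) ≫ r = p ≫ q ≫ r := by simp
  exact (key _ _ _).trans (constraint_comp (T := fun k => η.app ⟨k⟩) (U := fun k => θ.app ⟨k⟩)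
    c d f (η.naturality f.toLoc).hom.toNatTrans (θ.naturality f.toLoc).hom.toNatTrans y
    (hc f y) (hd f _) _ _)

end Category

end LevelwiseModel

end WeaklyGlobular

namespace WeaklyGlobular

/-! ### Spines -/

/-- The object `([1], …, [1])`. -/
def Idx.one : ∀ m : ℕ, Idx m
  | 0 => Idx.pt
  | m + 1 => (Idx.consEquiv m).functor.obj (ord 1, Idx.one m)

/-- The first coordinate of a map of `Δ^{op (m+1)}`. -/
abbrev Idx.homFst {m : ℕ} {k l : Idx (m + 1)} (f : k ⟶ l) :
    ((Idx.consEquiv m).inverse.obj k).1 ⟶ ((Idx.consEquiv m).inverse.obj l).1 :=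
  ((Idx.consEquiv m).inverse.map f).1

/-- The other coordinates of a map of `Δ^{op (m+1)}`. -/
abbrev Idx.homSnd {m : ℕ} {k l : Idx (m + 1)} (f : k ⟶ l) :
    ((Idx.consEquiv m).inverse.obj k).2 ⟶ ((Idx.consEquiv m).inverse.obj l).2 :=
  ((Idx.consEquiv m).inverse.map f).2

theorem Idx.hom_ext {m : ℕ} {k l : Idx (m + 1)} {f g : k ⟶ l} (h₁ : Idx.homFst f = Idx.homFst g)
    (h₂ : Idx.homSnd f = Idx.homSnd g) : f = g :=
  Prod.ext h₁ h₂

/-- The map of `Δ^{op (m+1)}` with given coordinates. -/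
abbrev Idx.homMk {m : ℕ} {k l : Idx (m + 1)}
    (f : ((Idx.consEquiv m).inverse.obj k).1 ⟶ ((Idx.consEquiv m).inverse.obj l).1)
    (g : ((Idx.consEquiv m).inverse.obj k).2 ⟶ ((Idx.consEquiv m).inverse.obj l).2) : k ⟶ l :=
  Prod.mk f g

/-- The maps of `Δ^{op m}` to `([1], …, [1])` all of whose coordinates are given by maps `ν_j`. -/
def IsSpine : ∀ (m : ℕ) {k : Idx m}, (k ⟶ Idx.one m) → Prop
  | 0, _, _ => True
  | m + 1, k, f =>
    (∃ j : Fin ((Idx.consEquiv m).inverse.obj k).1.unop.len, Idx.homFst f = spineMap j) ∧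
    IsSpine m (Idx.homSnd f)

theorem spineMap_injective {k : ℕ} : Function.Injective (spineMap (k := k)) := by
  intro i j h
  have h' : SimplexCategory.mkOfSucc i = SimplexCategory.mkOfSucc j := Quiver.Hom.op_inj h
  have := congrArg (fun f => (f.toOrderHom 0).val) h'
  exact Fin.ext this

theorem spineMap_one (j : Fin 1) : spineMap j = 𝟙 (ord 1) := by
  obtain rfl := Subsingleton.elim j 0
  apply Quiver.Hom.unop_inj
  apply SimplexCategory.Hom.ext
  ext i
  fin_cases i <;> rfl

/-- Together with `exists_spine_factor` and `spine_factor_unique` this gives the bijection between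
spines of `k(r,i)` and pairs of an edge of `[r]` and a spine of `k(1,i)`. -/
theorem isSpine_dir : ∀ (m : ℕ) (k : Idx m) (i : Fin m) (r : ℕ) (a : Fin r)
    (ψ : (Idx.dir m k i).obj (ord 1) ⟶ Idx.one m), IsSpine m ψ →
      IsSpine m ((Idx.dir m k i).map (spineMap a) ≫ ψ)
  | m + 1, k, i, r, a, ψ, h => by
    obtain ⟨⟨j, hj⟩, h2⟩ := h
    induction i using Fin.cases with
    | zero =>
      refine ⟨⟨a, ?_⟩, ?_⟩
      · exact (congrArg (spineMap a ≫ ·) (hj.trans (spineMap_one j))).trans (Category.comp_id _)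
      · have e : Idx.homSnd ((Idx.dir (m + 1) k 0).map (spineMap a) ≫ ψ) = Idx.homSnd ψ :=
          Category.id_comp _
        exact e.symm ▸ h2
    | succ i => exact ⟨⟨j, (Category.id_comp _).trans hj⟩, isSpine_dir m _ i r a _ h2⟩

theorem exists_spine_factor : ∀ (m : ℕ) (k : Idx m) (i : Fin m) (r : ℕ)
    (ψ : (Idx.dir m k i).obj (ord r) ⟶ Idx.one m), IsSpine m ψ →
      ∃ (a : Fin r) (ψ' : (Idx.dir m k i).obj (ord 1) ⟶ Idx.one m), IsSpine m ψ' ∧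
        (Idx.dir m k i).map (spineMap a) ≫ ψ' = ψ
  | m + 1, k, i, r, ψ, h => by
    obtain ⟨⟨j, hj⟩, h2⟩ := h
    induction i using Fin.cases with
    | zero =>
      refine ⟨j, Idx.homMk (k := (Idx.dir (m + 1) k 0).obj (ord 1)) (l := Idx.one (m + 1)) (𝟙 _)
        (Idx.homSnd (k := (Idx.dir (m + 1) k 0).obj (ord r)) ψ),
        ⟨⟨(0 : Fin 1), (spineMap_one 0).symm⟩, h2⟩, Idx.hom_ext ?_ ?_⟩
      · exact (Category.comp_id _).trans hj.symm
      · exact Category.id_comp _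
    | succ i =>
      obtain ⟨a, ψ', h', e⟩ := exists_spine_factor m _ i r (Idx.homSnd ψ) h2
      exact ⟨a, Idx.homMk (k := (Idx.dir (m + 1) k i.succ).obj (ord 1)) (l := Idx.one (m + 1))
        (Idx.homFst (k := (Idx.dir (m + 1) k i.succ).obj (ord r)) ψ) ψ',
        ⟨⟨j, hj⟩, h'⟩, Idx.hom_ext (Category.id_comp _) e⟩

theorem spine_factor_unique : ∀ (m : ℕ) (k : Idx m) (i : Fin m) (r : ℕ) (a b : Fin r)
    (ψ φ : (Idx.dir m k i).obj (ord 1) ⟶ Idx.one m), IsSpine m ψ → IsSpine m φ →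
      (Idx.dir m k i).map (spineMap a) ≫ ψ = (Idx.dir m k i).map (spineMap b) ≫ φ →
        a = b ∧ ψ = φ
  | m + 1, k, i, r, a, b, ψ, φ, hψ, hφ, h => by
    obtain ⟨⟨j, hj⟩, h2⟩ := hψ
    obtain ⟨⟨j', hj'⟩, h2'⟩ := hφ
    have e1 := congrArg Idx.homFst h
    have e2 := congrArg Idx.homSnd h
    induction i using Fin.cases with
    | zero =>
      have c1 : Idx.homFst ψ = 𝟙 _ := hj.trans (spineMap_one j)
      have c2 : Idx.homFst φ = 𝟙 _ := hj'.trans (spineMap_one j')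
      refine ⟨?_, Idx.hom_ext (c1.trans c2.symm) ?_⟩
      · have d1 : spineMap a ≫ Idx.homFst ψ = spineMap b ≫ Idx.homFst φ := e1
        have d2 : spineMap a ≫ Idx.homFst ψ = spineMap a :=
          (congrArg (spineMap a ≫ ·) c1).trans (Category.comp_id _)
        have d3 : spineMap b ≫ Idx.homFst φ = spineMap b :=
          (congrArg (spineMap b ≫ ·) c2).trans (Category.comp_id _)
        exact spineMap_injective (d2.symm.trans (d1.trans d3))
      · have d1 : 𝟙 _ ≫ Idx.homSnd ψ = 𝟙 _ ≫ Idx.homSnd φ := e2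
        rwa [Category.id_comp, Category.id_comp] at d1
    | succ i =>
      obtain ⟨ha, hs⟩ := spine_factor_unique m _ i r a b _ _ h2 h2' e2
      have d1 : 𝟙 _ ≫ Idx.homFst ψ = 𝟙 _ ≫ Idx.homFst φ := e1
      rw [Category.id_comp, Category.id_comp] at d1
      exact ⟨ha, Idx.hom_ext d1 hs⟩

/-- A spine selects an edge in direction `i`, and `[0]` has none. -/
theorem not_isSpine_dir_zero {m : ℕ} {k : Idx m} {i : Fin m}
    {ψ : (Idx.dir m k i).obj (ord 0) ⟶ Idx.one m} : ¬ IsSpine m ψ := fun h => by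
  obtain ⟨a, -⟩ := exists_spine_factor m k i 0 ψ h
  exact a.elim0

/-! ### Diagrams with weak Segal conditions in all directions -/

/-- A simplicial category whose objects of degree `0` form an equivalence relation and whose Segal
maps over the isomorphism classes of degree `0` are equivalences. -/
structure IsWeakSegal (F : SimplicialObject Cat.{u, u}) : Prop where
  thin : Quiver.IsThin (F.obj (ord 0))
  groupoid : IsGroupoid (F.obj (ord 0))
  full {r : ℕ} (hr : 2 ≤ r) :
    (Functor.pi' fun a : Fin r => (F.map (spineMap a)).toFunctor).Full
  faithful {r : ℕ} (hr : 2 ≤ r) :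
    (Functor.pi' fun a : Fin r => (F.map (spineMap a)).toFunctor).Faithful
  exists_iso {r : ℕ} (hr : 2 ≤ r) (x : Fin r → F.obj (ord 1))
    (hx : chain (C := F.obj (ord 1)) r (fun x => isoClass ((F.map srcMap).toFunctor.obj x))
      (fun x => isoClass ((F.map tgtMap).toFunctor.obj x)) x) :
    ∃ y : F.obj (ord r), ∀ a, Nonempty ((F.map (spineMap a)).toFunctor.obj y ≅ x a)

/-- Weak Segal conditions in all directions. -/
def IsMultiSegal {m : ℕ} (X : MCat.{u} m) : Prop :=
  ∀ (k : Idx m) (i : Fin m), IsWeakSegal (Idx.dir m k i ⋙ X)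

theorem IsMultiSegal.level {m : ℕ} {X : MCat.{u} (m + 1)} (h : IsMultiSegal X) (r : ℕ) :
    IsMultiSegal (level X r) := fun k i =>
  h ((Idx.consEquiv m).functor.obj (ord r, k)) i.succ

theorem isoClass_eq_iff {C : Cat.{u, u}} {x y : C} :
    isoClass x = isoClass y ↔ Nonempty (x ≅ y) :=
  Quotient.eq (r := isIsomorphicSetoid C)

/-- The connected component of an object. -/
abbrev comp {C : Cat.{u, u}} (x : C) : qCat.obj C := pToQ C (isoClass x)

theorem comp_eq_of_hom {C : Cat.{u, u}} {x y : C} (f : x ⟶ y) : comp x = comp y :=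
  Quotient.sound (Zigzag.of_hom f)

theorem comp_map {C D : Cat.{u, u}} (F : C ⟶ D) {x y : C} (h : comp x = comp y) :
    comp (F.toFunctor.obj x) = comp (F.toFunctor.obj y) :=
  congrArg (qCat.map F) h

theorem IsWeakSegal.nonempty_hom {F : SimplicialObject Cat.{u, u}} (h : IsWeakSegal F)
    {x y : F.obj (ord 0)} (e : comp x = comp y) : Nonempty (x ⟶ y) := by
  have := h.groupoid
  obtain ⟨i⟩ := isoClass_eq_iff.1 ((pToQ_bijective (F.obj (ord 0))).1 e)
  exact ⟨i.hom⟩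

/-- The functors to the factors of degree `1` are jointly fully faithful. -/
theorem IsWeakSegal.existsUnique {F : SimplicialObject Cat.{u, u}} (h : IsWeakSegal F) {r : ℕ}
    {x y : F.obj (ord r)} (e : comp x = comp y)
    (u : ∀ a : Fin r, (F.map (spineMap a)).toFunctor.obj x ⟶ (F.map (spineMap a)).toFunctor.obj y) :
    ∃! w : x ⟶ y, ∀ a, (F.map (spineMap a)).toFunctor.map w = u a := by
  match r with
  -- There are no edges, so existence comes from the equality of components and uniqueness from
  -- thinness.
  | 0 =>
    obtain ⟨w⟩ := h.nonempty_hom e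
    exact ⟨w, fun a => a.elim0, fun _ _ => (h.thin _ _).elim _ _⟩
  -- The Segal hypotheses start at `r = 2`; for `r = 1` the only spine map is the identity.
  | 1 =>
    have : IsIso (F.map (spineMap (0 : Fin 1))) := by rw [spineMap_one]; infer_instance
    have : (F.map (spineMap (0 : Fin 1))).toFunctor.IsEquivalence :=
      (Cat.equivOfIso (asIso (F.map (spineMap (0 : Fin 1))))).isEquivalence_functor
    obtain ⟨w, hw⟩ := (F.map (spineMap (0 : Fin 1))).toFunctor.map_surjective (u 0)
    refine ⟨w, fun a => ?_, fun w' hw' => ?_⟩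
    · obtain rfl := Subsingleton.elim a 0
      exact hw
    · exact (F.map (spineMap (0 : Fin 1))).toFunctor.map_injective ((hw' 0).trans hw.symm)
  | r + 2 =>
    have := h.full (r := r + 2) (by omega)
    have := h.faithful (r := r + 2) (by omega)
    obtain ⟨w, hw⟩ := (Functor.pi' fun a : Fin (r + 2) =>
      (F.map (spineMap a)).toFunctor).map_surjective (X := x) (Y := y) u
    refine ⟨w, fun a => congrFun hw a, fun w' hw' => ?_⟩
    exact (Functor.pi' fun a : Fin (r + 2) =>
      (F.map (spineMap a)).toFunctor).map_injective ((funext hw').trans hw.symm)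

theorem eq_of_comp_eqToHom_eq {C : Type*} [Category* C] {a a' b b' : C} {f g : a ⟶ b}
    {f' : a' ⟶ b'} (p : a = a') (q : b = b') (h : f ≫ eqToHom q = eqToHom p ≫ f')
    (h' : f' = eqToHom p.symm ≫ g ≫ eqToHom q) : f = g := by
  subst p q
  simpa [h'] using h

/-- The functors to the factor of degree `(1, …, 1)` given by the spines are jointly fully
faithful. -/
theorem IsMultiSegal.existsUnique : ∀ (m : ℕ) {X : MCat.{u} m} (_ : IsMultiSegal X) {k : Idx m}
    {x y : X.obj k} (_ : comp x = comp y)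
    (u : ∀ ψ : {ψ : k ⟶ Idx.one m // IsSpine m ψ},
      (X.map ψ.1).toFunctor.obj x ⟶ (X.map ψ.1).toFunctor.obj y),
    ∃! w : x ⟶ y, ∀ ψ, (X.map ψ.1).toFunctor.map w = u ψ
  | 0, X, h, k, x, y, e, u => by
    obtain rfl := Idx.eq_pt k
    have : (X.map (𝟙 Idx.pt)).toFunctor.IsEquivalence :=
      (Cat.equivOfIso (asIso (X.map (𝟙 Idx.pt)))).isEquivalence_functor
    obtain ⟨w, hw⟩ := (X.map (𝟙 Idx.pt)).toFunctor.map_surjective (u ⟨𝟙 Idx.pt, trivial⟩)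
    refine ⟨w, fun ψ => ?_, fun w' hw' => ?_⟩
    · obtain rfl : ψ = ⟨𝟙 Idx.pt, trivial⟩ := Subtype.ext (Subsingleton.elim _ _)
      exact hw
    · exact (X.map (𝟙 Idx.pt)).toFunctor.map_injective ((hw' ⟨𝟙 Idx.pt, trivial⟩).trans hw.symm)
  | m + 1, X, h, k, x, y, e, u => by
    let s : Idx m := ((Idx.consEquiv m).inverse.obj k).2
    let r : ℕ := ((Idx.consEquiv m).inverse.obj k).1.unop.len
    -- Each spine is an edge `φ a` in the first direction followed by a spine `χ ψ` in the remaining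
    -- ones.
    let φ (a : Fin r) : k ⟶ (Idx.dir (m + 1) k 0).obj (ord 1) :=
      (Idx.dir (m + 1) k 0).map (spineMap a)
    let χ (ψ : s ⟶ Idx.one m) : (Idx.dir (m + 1) k 0).obj (ord 1) ⟶ Idx.one (m + 1) :=
      Idx.homMk (k := (Idx.dir (m + 1) k 0).obj (ord 1)) (l := Idx.one (m + 1)) (𝟙 _) ψ
    have hχ (a : Fin r) (ψ : {ψ : s ⟶ Idx.one m // IsSpine m ψ}) :
        IsSpine (m + 1) (φ a ≫ χ ψ.1) :=
      isSpine_dir (m + 1) k 0 r a (χ ψ.1) ⟨⟨(0 : Fin 1), (spineMap_one 0).symm⟩, ψ.2⟩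
    have hφ (ψ : k ⟶ Idx.one (m + 1)) (hψ : IsSpine (m + 1) ψ) :
        ∃ (a : Fin r) (ψ' : {ψ : s ⟶ Idx.one m // IsSpine m ψ}), φ a ≫ χ ψ'.1 = ψ := by
      obtain ⟨a, ψ', ⟨⟨j, hj⟩, h2⟩, e⟩ := exists_spine_factor (m + 1) k 0 r ψ hψ
      refine ⟨a, ⟨Idx.homSnd ψ', h2⟩, Eq.trans ?_ e⟩
      have : χ (Idx.homSnd ψ') = ψ' := Idx.hom_ext (hj.trans (spineMap_one j)).symm rfl
      exact congrArg (φ a ≫ ·) this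
    -- Over each edge `a` the induction hypothesis for `X_1` yields one morphism `v a`; the first
    -- direction then assembles the `v a`.
    have ih (a : Fin r) := IsMultiSegal.existsUnique m (h.level 1) (k := s)
      (x := (X.map (φ a)).toFunctor.obj x) (y := (X.map (φ a)).toFunctor.obj y)
      (comp_map (X.map (φ a)) e)
      (fun ψ => eqToHom (LevelwiseModel.obj_map_comp (φ a) (χ ψ.1) x).symm ≫
        u ⟨φ a ≫ χ ψ.1, hχ a ψ⟩ ≫ eqToHom (LevelwiseModel.obj_map_comp (φ a) (χ ψ.1) y))
    choose v hv hv' using ih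
    obtain ⟨w, hw, hw'⟩ := (h k 0).existsUnique (r := r) e v
    refine ⟨w, fun ψ => ?_, fun w' h' => hw' w' fun a => hv' a _ fun ψ => ?_⟩
    · obtain ⟨ψ, hψ⟩ := ψ
      obtain ⟨a, ψ', rfl⟩ := hφ ψ hψ
      have e1 := LevelwiseModel.map_comp_map (φ a) (χ ψ'.1) w
      have e2 : (X.map (χ ψ'.1)).toFunctor.map ((X.map (φ a)).toFunctor.map w) = _ :=
        (congrArg (X.map (χ ψ'.1)).toFunctor.map (hw a)).trans (hv a ψ')
      exact eq_of_comp_eqToHom_eq _ _ e1 e2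
    · have e1 := LevelwiseModel.map_comp_map (φ a) (χ ψ.1) w'
      rw [h' ⟨_, hχ a ψ⟩, ← eqToHom_comp_iff] at e1
      exact e1.symm

end WeaklyGlobular

namespace WeaklyGlobular

/-! ### The strictly Segal model of a diagram with weak Segal conditions -/

section Grid

variable {m : ℕ}

/-- The objects of the strictly Segal model at `k`: an isomorphism class of objects of `X_k`
together with representatives of its images in `X_{1, …, 1}` under the spines. -/
@[ext]
structure GridObj (X : MCat.{u} m) (k : Idx m) : Type u where
  /-- The isomorphism class. -/
  cls : pCat.obj (X.obj k)
  /-- The representatives. -/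
  pt : {ψ : k ⟶ Idx.one m // IsSpine m ψ} → X.obj (Idx.one m)
  isoClass_pt : ∀ ψ, isoClass (pt ψ) = pCat.map (X.map ψ.1) cls

/-- The morphisms of the strictly Segal model. -/
@[ext]
structure GridHom {X : MCat.{u} m} {k : Idx m} (a b : GridObj X k) : Type u where
  -- When `k` has no spines this condition is all there is to a morphism.
  comp_eq : pToQ _ a.cls = pToQ _ b.cls
  /-- The components. -/
  app : ∀ ψ, a.pt ψ ⟶ b.pt ψ

instance GridObj.category (X : MCat.{u} m) (k : Idx m) : Category.{u} (GridObj X k) where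
  Hom := GridHom
  id _ := ⟨rfl, fun _ => 𝟙 _⟩
  comp f g := ⟨f.comp_eq.trans g.comp_eq, fun ψ => f.app ψ ≫ g.app ψ⟩
  id_comp _ := GridHom.ext (funext fun _ => Category.id_comp _)
  comp_id _ := GridHom.ext (funext fun _ => Category.comp_id _)
  assoc _ _ _ := GridHom.ext (funext fun _ => Category.assoc _ _ _)

@[ext]
theorem GridObj.hom_ext {X : MCat.{u} m} {k : Idx m} {a b : GridObj X k} {f g : a ⟶ b}
    (h : ∀ ψ, f.app ψ = g.app ψ) : f = g :=
  GridHom.ext (funext h)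

theorem GridObj.eqToHom_app {X : MCat.{u} m} {k : Idx m} {a b : GridObj X k} (h : a = b)
    (ψ : {ψ : k ⟶ Idx.one m // IsSpine m ψ}) :
    (eqToHom h).app ψ = eqToHom (congrArg (fun a => a.pt ψ) h) := by
  subst h; rfl

/-- The isomorphism given by isomorphisms of the components. -/
def GridObj.isoMk {X : MCat.{u} m} {k : Idx m} {a b : GridObj X k}
    (h : pToQ _ a.cls = pToQ _ b.cls) (e : ∀ ψ, a.pt ψ ≅ b.pt ψ) : a ≅ b where
  hom := ⟨h, fun ψ => (e ψ).hom⟩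
  inv := ⟨h.symm, fun ψ => (e ψ).inv⟩
  hom_inv_id := GridObj.hom_ext fun ψ => (e ψ).hom_inv_id
  inv_hom_id := GridObj.hom_ext fun ψ => (e ψ).inv_hom_id

/-- The functor which takes the representative at a spine. -/
def GridObj.ev (X : MCat.{u} m) {k : Idx m} (ψ : {ψ : k ⟶ Idx.one m // IsSpine m ψ}) :
    GridObj X k ⥤ X.obj (Idx.one m) where
  obj a := a.pt ψ
  map f := f.app ψ

theorem GridObj.functor_ext {X : MCat.{u} m} {k : Idx m} {C : Type*} [Category* C]
    {F G : C ⥤ GridObj X k} (h : ∀ c, (F.obj c).cls = (G.obj c).cls)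
    (h' : ∀ ψ, F ⋙ GridObj.ev X ψ = G ⋙ GridObj.ev X ψ) : F = G := by
  have ho (c : C) : F.obj c = G.obj c :=
    GridObj.ext (h c) (funext fun ψ => Functor.congr_obj (h' ψ) c)
  refine CategoryTheory.Functor.ext ho fun c d f => GridObj.hom_ext fun ψ => ?_
  change _ = (eqToHom (ho c)).app ψ ≫ (G.map f).app ψ ≫ (eqToHom (ho d).symm).app ψ
  rw [GridObj.eqToHom_app, GridObj.eqToHom_app]
  exact Functor.congr_hom (h' ψ) f

theorem pToQ_map {C D : Cat.{u, u}} (F : C ⟶ D) (z : pCat.obj C) :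
    pToQ D (pCat.map F z) = qCat.map F (pToQ C z) := by
  induction z using Quotient.inductionOn with
  | h x => rfl

variable (X : MCat.{u} m)

/-- The comparison functor to the strictly Segal model. -/
def toGrid (k : Idx m) : X.obj k ⥤ GridObj X k where
  obj y := ⟨isoClass y, fun ψ => (X.map ψ.1).toFunctor.obj y, fun _ => rfl⟩
  map f := ⟨comp_eq_of_hom f, fun ψ => (X.map ψ.1).toFunctor.map f⟩
  map_id _ := GridObj.hom_ext fun _ => CategoryTheory.Functor.map_id _ _
  map_comp _ _ := GridObj.hom_ext fun _ => Functor.map_comp _ _ _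

/-- Any object in the class `a.cls` works, as its images are isomorphic to the chosen
representatives; no Segal condition is involved. The equality of classes is recorded because an
isomorphism of grid objects by definition only equates components. -/
theorem exists_iso_toGrid {k : Idx m} (a : GridObj X k) :
    ∃ y, isoClass y = a.cls ∧ Nonempty ((toGrid X k).obj y ≅ a) := by
  obtain ⟨y, hy⟩ := Quotient.exists_rep a.cls
  have hy : isoClass y = a.cls := hy
  have e (ψ) : Nonempty ((X.map ψ.1).toFunctor.obj y ≅ a.pt ψ) := by
    rw [← isoClass_eq_iff, a.isoClass_pt ψ, ← hy]
    rfl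
  exact ⟨y, hy, ⟨GridObj.isoMk (congrArg (pToQ _) hy) fun ψ => (e ψ).some⟩⟩

variable {X}

theorem toGrid_isEquivalence (hX : IsMultiSegal X) (k : Idx m) : (toGrid X k).IsEquivalence where
  faithful := ⟨fun {x y} f g h => by
    obtain ⟨w, -, hw⟩ := IsMultiSegal.existsUnique m hX (comp_eq_of_hom f)
      (fun ψ => (X.map ψ.1).toFunctor.map f)
    exact (hw f fun ψ => rfl).trans (hw g fun ψ => congrFun (congrArg GridHom.app h.symm) ψ).symm⟩
  full := ⟨fun {x y} f => by
    obtain ⟨w, hw, -⟩ := IsMultiSegal.existsUnique m hX f.comp_eq f.app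
    exact ⟨w, GridObj.hom_ext hw⟩⟩
  essSurj := ⟨fun a => by
    obtain ⟨y, -, ⟨e⟩⟩ := exists_iso_toGrid X a
    exact ⟨y, ⟨e⟩⟩⟩

/-- On spines the projection itself extends `X.map ψ`, and strictness of the Segal maps requires
exactly this choice. On other maps an inverse of `toGrid` serves. -/
theorem exists_gridProj (hX : IsMultiSegal X) {k : Idx m} (ψ : k ⟶ Idx.one m) :
    ∃ E : GridObj X k ⥤ X.obj (Idx.one m), Nonempty (toGrid X k ⋙ E ≅ (X.map ψ).toFunctor) ∧
      ∀ h : IsSpine m ψ, E = GridObj.ev X ⟨ψ, h⟩ := by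
  by_cases h : IsSpine m ψ
  · exact ⟨GridObj.ev X ⟨ψ, h⟩, ⟨Iso.refl _⟩, fun _ => rfl⟩
  · have := toGrid_isEquivalence hX k
    exact ⟨(toGrid X k).inv ⋙ (X.map ψ).toFunctor,
      ⟨Functor.isoWhiskerRight (toGrid X k).asEquivalence.unitIso.symm (X.map ψ).toFunctor⟩,
      fun h' => (h h').elim⟩

variable (hX : IsMultiSegal X)

/-- The functor from the model at `k` to `X_{1, …, 1}` induced by a map, which is the projection if
the map is a spine. -/
noncomputable def gridProj {k : Idx m} (ψ : k ⟶ Idx.one m) : GridObj X k ⥤ X.obj (Idx.one m) :=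
  (exists_gridProj hX ψ).choose

/-- The projections extend the transition functors of `X`. -/
noncomputable def gridProjIso {k : Idx m} (ψ : k ⟶ Idx.one m) :
    toGrid X k ⋙ gridProj hX ψ ≅ (X.map ψ).toFunctor :=
  (exists_gridProj hX ψ).choose_spec.1.some

theorem gridProj_eq_ev {k : Idx m} (ψ : k ⟶ Idx.one m) (h : IsSpine m ψ) :
    gridProj hX ψ = GridObj.ev X ⟨ψ, h⟩ :=
  (exists_gridProj hX ψ).choose_spec.2 h

theorem isoClass_gridProj {k : Idx m} (ψ : k ⟶ Idx.one m) (a : GridObj X k) :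
    isoClass ((gridProj hX ψ).obj a) = pCat.map (X.map ψ) a.cls := by
  obtain ⟨y, hy, ⟨e⟩⟩ := exists_iso_toGrid X a
  rw [← hy]
  exact isoClass_eq_iff.2 ⟨(gridProj hX ψ).mapIso e.symm ≪≫ (gridProjIso hX ψ).app y⟩

/-- The transition functors of the strictly Segal model. -/
noncomputable def gridMap {k l : Idx m} (f : k ⟶ l) : GridObj X k ⥤ GridObj X l where
  obj a := ⟨pCat.map (X.map f) a.cls, fun ψ => (gridProj hX (f ≫ ψ.1)).obj a, fun ψ => by
    rw [isoClass_gridProj, X.map_comp, pCat.map_comp]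
    rfl⟩
  map {a b} g := ⟨by rw [pToQ_map, pToQ_map, g.comp_eq], fun ψ => (gridProj hX (f ≫ ψ.1)).map g⟩
  map_id _ := GridObj.hom_ext fun _ => CategoryTheory.Functor.map_id _ _
  map_comp _ _ := GridObj.hom_ext fun _ => Functor.map_comp _ _ _

/-- The source of all strictness: along composites that are spines, the transition functor only
reindexes representatives. -/
theorem gridMap_pt {k l : Idx m} (f : k ⟶ l) (a : GridObj X k)
    (ψ : {ψ : l ⟶ Idx.one m // IsSpine m ψ}) (h : IsSpine m (f ≫ ψ.1)) :
    ((gridMap hX f).obj a).pt ψ = a.pt ⟨f ≫ ψ.1, h⟩ :=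
  Functor.congr_obj (gridProj_eq_ev hX (f ≫ ψ.1) h) a

/-- The comparison squares of the strictly Segal model. -/
noncomputable def gridSquare {k l : Idx m} (f : k ⟶ l) :
    toGrid X k ⋙ gridMap hX f ≅ (X.map f).toFunctor ⋙ toGrid X l :=
  NatIso.ofComponents (fun y => GridObj.isoMk rfl fun ψ =>
      (gridProjIso hX (f ≫ ψ.1)).app y ≪≫ eqToIso (LevelwiseModel.obj_map_comp f ψ.1 y))
    (fun {y z} g => GridObj.hom_ext fun ψ => by
      have h1 : (gridProj hX (f ≫ ψ.1)).map ((toGrid X k).map g) ≫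
          (gridProjIso hX (f ≫ ψ.1)).hom.app z = (gridProjIso hX (f ≫ ψ.1)).hom.app y ≫
          (X.map (f ≫ ψ.1)).toFunctor.map g := (gridProjIso hX (f ≫ ψ.1)).hom.naturality g
      change (gridProj hX (f ≫ ψ.1)).map ((toGrid X k).map g) ≫
          (gridProjIso hX (f ≫ ψ.1)).hom.app z ≫
            eqToHom (LevelwiseModel.obj_map_comp f ψ.1 z) =
        ((gridProjIso hX (f ≫ ψ.1)).hom.app y ≫ eqToHom (LevelwiseModel.obj_map_comp f ψ.1 y)) ≫
          (X.map ψ.1).toFunctor.map ((X.map f).toFunctor.map g)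
      rw [reassoc_of% h1, LevelwiseModel.map_comp_map, Category.assoc])

/-- The strictly Segal model. -/
noncomputable def gridModel : LevelwiseModel X where
  obj k := Cat.of (GridObj X k)
  map f := (gridMap hX f).toCatHom
  unit k := (toGrid X k).toCatHom
  equiv k := toGrid_isEquivalence hX k
  square f := gridSquare hX f

end Grid

/-! ### Functoriality of the strictly Segal model. -/

section GridFunctoriality

variable {m : ℕ} {X Y Z : MCat.{u} m}

/-- The functoriality of the strictly Segal model. -/
def gridHom (F : X ⟶ Y) (k : Idx m) : GridObj X k ⥤ GridObj Y k where
  obj a := ⟨pCat.map (F.app k) a.cls, fun ψ => (F.app _).toFunctor.obj (a.pt ψ), fun ψ => by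
    have h := congrArg (fun G => pCat.map G a.cls) (F.naturality ψ.1)
    have h1 : pCat.map (F.app _) (pCat.map (X.map ψ.1) a.cls) =
        pCat.map (Y.map ψ.1) (pCat.map (F.app k) a.cls) := by
      rw [pCat.map_comp, pCat.map_comp] at h
      exact h
    rw [← h1, ← a.isoClass_pt]
    rfl⟩
  map {a b} g := ⟨by rw [pToQ_map, pToQ_map, g.comp_eq], fun ψ => (F.app _).toFunctor.map (g.app ψ)⟩
  map_id _ := GridObj.hom_ext fun _ => CategoryTheory.Functor.map_id _ _
  map_comp _ _ := GridObj.hom_ext fun _ => Functor.map_comp _ _ _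

/-- An equality, not just an isomorphism: at each spine it is the strict naturality of `F`. This is
the input of `homTrans`. -/
theorem gridHom_comm (F : X ⟶ Y) (k : Idx m) :
    toGrid X k ⋙ gridHom F k = (F.app k).toFunctor ⋙ toGrid Y k :=
  GridObj.functor_ext (fun _ => rfl)
    fun ψ => congrArg Cat.Hom.toFunctor (F.naturality ψ.1)

theorem gridHom_id (k : Idx m) : gridHom (𝟙 X) k = 𝟭 _ :=
  GridObj.functor_ext (fun a => by
    change pCat.map (𝟙 _) a.cls = a.cls
    rw [pCat.map_id]; rfl) fun ψ => rfl

theorem gridHom_comp (F : X ⟶ Y) (G : Y ⟶ Z) (k : Idx m) :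
    gridHom (F ≫ G) k = gridHom F k ⋙ gridHom G k :=
  GridObj.functor_ext (fun a => by
    change pCat.map (F.app k ≫ G.app k) a.cls = pCat.map (G.app k) (pCat.map (F.app k) a.cls)
    rw [pCat.map_comp]; rfl) fun ψ => rfl

/-- The pseudo-natural transformation of strictly Segal models induced by a natural
transformation. -/
noncomputable def gridTrans (hX : IsMultiSegal X) (hY : IsMultiSegal Y) (F : X ⟶ Y) :
    (show PsFun.{u} m from (gridModel hX).pseudofunctor) ⟶ (gridModel hY).pseudofunctor :=
  LevelwiseModel.homTrans (M := gridModel hX) (N := gridModel hY) (F := F)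
    (fun k => (gridHom F k).toCatHom) fun k => Cat.ext (gridHom_comm F k)

theorem gridTrans_isCompatible (hX : IsMultiSegal X) (hY : IsMultiSegal Y) (F : X ⟶ Y) :
    LevelwiseModel.IsCompatible F (gridTrans hX hY F) :=
  LevelwiseModel.homTrans_isCompatible _ _

theorem gridTrans_id (hX : IsMultiSegal X) : gridTrans hX hX (𝟙 X) = 𝟙 _ :=
  (gridTrans_isCompatible hX hX (𝟙 X)).ext (LevelwiseModel.isCompatible_id (gridModel hX))
    (funext fun k => Cat.ext (gridHom_id k.as))

theorem gridTrans_comp (hX : IsMultiSegal X) (hY : IsMultiSegal Y) (hZ : IsMultiSegal Z)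
    (F : X ⟶ Y) (G : Y ⟶ Z) :
    gridTrans hX hZ (F ≫ G) = gridTrans hX hY F ≫ gridTrans hY hZ G :=
  (gridTrans_isCompatible hX hZ (F ≫ G)).ext
    ((gridTrans_isCompatible hX hY F).comp (gridTrans_isCompatible hY hZ G))
    (funext fun k => Cat.ext (gridHom_comp F G k.as))

end GridFunctoriality

end WeaklyGlobular

namespace WeaklyGlobular

/-! ### The Segal conditions for the model -/

section FullyFaithful

variable {A C D : Type*} [Category* A] [Category* C] [Category* D]

theorem full_of_equivalence_comp (g : A ⥤ C) [g.IsEquivalence] (P : C ⥤ D) [(g ⋙ P).Full] :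
    P.Full :=
  Functor.Full.of_iso (F := g.inv ⋙ g ⋙ P)
    ((Functor.associator _ _ _).symm ≪≫
      Functor.isoWhiskerRight g.asEquivalence.counitIso P ≪≫ P.leftUnitor)

theorem faithful_of_equivalence_comp (g : A ⥤ C) [g.IsEquivalence] (P : C ⥤ D)
    [(g ⋙ P).Faithful] : P.Faithful :=
  Functor.Faithful.of_iso (F := g.inv ⋙ g ⋙ P)
    ((Functor.associator _ _ _).symm ≪≫
      Functor.isoWhiskerRight g.asEquivalence.counitIso P ≪≫ P.leftUnitor)

/-- A fully faithful functor which is bijective on objects is an isomorphism. -/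
theorem isIso_toCatHom {C D : Type u} [Category.{u} C] [Category.{u} D] (F : C ⥤ D) [F.Full]
    [F.Faithful] (h : Function.Bijective F.obj) : IsIso F.toCatHom := by
  let e := Equiv.ofBijective F.obj h
  have he (d : D) : F.obj (e.symm d) = d := e.apply_symm_apply d
  have he' (c : C) : e.symm (F.obj c) = c := e.symm_apply_apply c
  let G : D ⥤ C :=
    { obj := e.symm
      map := fun {a b} f => F.preimage (eqToHom (he a) ≫ f ≫ eqToHom (he b).symm)
      map_id := fun a => F.map_injective (by simp)
      map_comp := fun f g => F.map_injective (by simp) }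
  have h₁ : F ⋙ G = 𝟭 C := CategoryTheory.Functor.ext he' fun a b f => F.map_injective (by
    simp [G, eqToHom_map])
  have h₂ : G ⋙ F = 𝟭 D := CategoryTheory.Functor.ext he fun a b f => by simp [G]
  exact ⟨G.toCatHom, Cat.ext h₁, Cat.ext h₂⟩

end FullyFaithful

variable {m : ℕ} {X : MCat.{u} m} (hX : IsMultiSegal X)

/-- Without spines, objects are isomorphism classes and morphisms are equalities of components; in
the groupoid `X_{k(0,i)}` equal components force equal classes. -/
theorem gridModel_psDiscrete : PsDiscrete (gridModel hX).pseudofunctor := fun k i =>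
  { subsingleton := fun a b => ⟨fun f g => by
      refine GridObj.hom_ext fun ψ => (not_isSpine_dir_zero ψ.2).elim⟩
    eq_of_hom := fun {a b} f => by
      have : IsGroupoid (X.obj ((Idx.dir m k i).obj (ord 0))) := (hX k i).groupoid
      exact GridObj.ext ((pToQ_bijective (X.obj ((Idx.dir m k i).obj (ord 0)))).1
        (GridHom.comp_eq f)) (funext fun ψ => (not_isSpine_dir_zero ψ.2).elim) }

/-- The functors from the model at `k(r, i)` to the model at `k(1, i)`. -/
noncomputable abbrev gridSpine (k : Idx m) (i : Fin m) (r : ℕ) :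
    GridObj X ((Idx.dir m k i).obj (ord r)) ⥤
      (Fin r → GridObj X ((Idx.dir m k i).obj (ord 1))) :=
  Functor.pi' fun a => gridMap hX ((Idx.dir m k i).map (spineMap a))

/-- The comparison of `gridSpine` with the spine of `X`. -/
noncomputable def gridSpineIso (k : Idx m) (i : Fin m) (r : ℕ) :
    toGrid X ((Idx.dir m k i).obj (ord r)) ⋙ gridSpine hX k i r ≅
      (Functor.pi' fun a : Fin r => ((Idx.dir m k i ⋙ X).map (spineMap a)).toFunctor) ⋙
        Functor.pi fun _ => toGrid X ((Idx.dir m k i).obj (ord 1)) :=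
  NatIso.ofComponents
    (fun y => Pi.isoMk fun a => (gridSquare hX ((Idx.dir m k i).map (spineMap a))).app y)
    (fun f => funext fun a => (gridSquare hX ((Idx.dir m k i).map (spineMap a))).hom.naturality f)

/-- Up to the equivalences `toGrid` at both ends, this is the fully faithful spine functor of `X`.
-/
theorem gridSpine_fullyFaithful (k : Idx m) (i : Fin m) {r : ℕ} (hr : 2 ≤ r) :
    (gridSpine hX k i r).Full ∧ (gridSpine hX k i r).Faithful := by
  have h (l) := toGrid_isEquivalence hX l
  have := (hX k i).full hr
  have := (hX k i).faithful hr
  have : (Functor.pi fun _ : Fin r => toGrid X ((Idx.dir m k i).obj (ord 1))).Full :=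
    ⟨fun f => ⟨fun a => (toGrid X _).preimage (f a), funext fun a => (toGrid X _).map_preimage _⟩⟩
  have : (Functor.pi fun _ : Fin r => toGrid X ((Idx.dir m k i).obj (ord 1))).Faithful :=
    ⟨fun h => funext fun a => (toGrid X _).map_injective (congrFun h a)⟩
  have := Functor.Full.of_iso (gridSpineIso hX k i r).symm
  have := Functor.Faithful.of_iso (gridSpineIso hX k i r).symm
  exact ⟨full_of_equivalence_comp (toGrid X _) _, faithful_of_equivalence_comp (toGrid X _) _⟩

/-- The class is recovered because a fully faithful functor reflects isomorphism of objects, and the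
representatives because every spine of `k(r,i)` factors through an edge. -/
theorem gridSpine_injective (k : Idx m) (i : Fin m) {r : ℕ} (hr : 2 ≤ r) :
    Function.Injective (gridSpine hX k i r).obj := by
  intro a b h
  have h (j : Fin r) : (gridMap hX ((Idx.dir m k i).map (spineMap j))).obj a =
    (gridMap hX ((Idx.dir m k i).map (spineMap j))).obj b := congrFun h j
  refine GridObj.ext ?_ (funext fun ψ => ?_)
  · obtain ⟨y, hy⟩ := Quotient.exists_rep a.cls
    obtain ⟨z, hz⟩ := Quotient.exists_rep b.cls
    have := (hX k i).full hr
    have := (hX k i).faithful hr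
    have e (j : Fin r) : Nonempty (((Idx.dir m k i ⋙ X).map (spineMap j)).toFunctor.obj y ≅
        ((Idx.dir m k i ⋙ X).map (spineMap j)).toFunctor.obj z) := by
      have := congrArg GridObj.cls (h j)
      change pCat.map _ a.cls = pCat.map _ b.cls at this
      rw [← hy, ← hz] at this
      exact isoClass_eq_iff.1 this
    rw [← hy, ← hz]
    exact isoClass_eq_iff.2 ⟨(Functor.pi' fun j : Fin r =>
      ((Idx.dir m k i ⋙ X).map (spineMap j)).toFunctor).preimageIso (Pi.isoMk fun j => (e j).some)⟩
  · obtain ⟨ψ, hψ⟩ := ψ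
    obtain ⟨j, ψ', h', rfl⟩ := exists_spine_factor m k i r ψ hψ
    have := congrArg (fun c => c.pt ⟨ψ', h'⟩) (h j)
    rwa [gridMap_pt hX _ _ _ hψ, gridMap_pt hX _ _ _ hψ] at this

/-- Matching objects in degree `0` have equal classes, which is precisely the hypothesis of the weak
Segal condition; it supplies the class. The representatives are concatenated along the factorization
of spines. -/
theorem gridSpine_surjective (k : Idx m) (i : Fin m) {r : ℕ} (hr : 2 ≤ r)
    (x : Fin r → GridObj X ((Idx.dir m k i).obj (ord 1)))
    (hx : chain (C := GridObj X ((Idx.dir m k i).obj (ord 1))) r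
      (gridMap hX ((Idx.dir m k i).map srcMap)).obj
      (gridMap hX ((Idx.dir m k i).map tgtMap)).obj x) :
    ∃ a, (gridSpine hX k i r).obj a = x := by
  choose y hy using fun j => Quotient.exists_rep (x j).cls
  obtain ⟨z, hz⟩ := (hX k i).exists_iso hr y (fun j l hjl => by
    have := congrArg GridObj.cls (hx j l hjl)
    change pCat.map _ (x j).cls = pCat.map _ (x l).cls at this
    rw [← hy j, ← hy l] at this
    exact this)
  have hz (j : Fin r) : pCat.map (X.map ((Idx.dir m k i).map (spineMap j))) (isoClass z) =
    (x j).cls := (isoClass_eq_iff.2 (hz j)).trans (hy j)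
  choose j ψ' h' e using fun ψ : {ψ : (Idx.dir m k i).obj (ord r) ⟶ Idx.one m // IsSpine m ψ} =>
    exists_spine_factor m k i r ψ.1 ψ.2
  refine ⟨⟨isoClass z, fun ψ => (x (j ψ)).pt ⟨ψ' ψ, h' ψ⟩, fun ψ => ?_⟩, ?_⟩
  · rw [(x (j ψ)).isoClass_pt, ← hz (j ψ), ← e ψ, X.map_comp, pCat.map_comp]
    rfl
  · funext l
    refine GridObj.ext (hz l) (funext fun ψ => ?_)
    have hs := isSpine_dir m k i r l ψ.1 ψ.2
    refine (gridMap_pt hX _ _ ψ hs).trans ?_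
    -- The chosen factorization of the spine through edge `l` must be the evident one.
    obtain ⟨h1, h2⟩ := spine_factor_unique m k i r _ _ _ _ (h' ⟨_, hs⟩) ψ.2 (e ⟨_, hs⟩)
    have h3 : (⟨ψ' ⟨_, hs⟩, h' ⟨_, hs⟩⟩ : {ψ // IsSpine m ψ}) = ψ := Subtype.ext h2
    change (x (j ⟨_, hs⟩)).pt ⟨ψ' ⟨_, hs⟩, h' ⟨_, hs⟩⟩ = _
    rw [h1, h3]

theorem gridModel_isIso_psSegal (k : Idx m) (i : Fin m) (r : ℕ) (hr : 2 ≤ r) :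
    IsIso (psSegal (gridModel hX).pseudofunctor (gridModel_psDiscrete hX) k i r) := by
  obtain ⟨h1, h2⟩ := gridSpine_fullyFaithful hX k i hr
  -- Followed by the inclusion of the fibre product into the product, `S` is `gridSpine`.
  let S := (psSegal (gridModel hX).pseudofunctor (gridModel_psDiscrete hX) k i r).toFunctor
  have : S.Full := ⟨fun f => by
    obtain ⟨w, hw⟩ := (gridSpine hX k i r).map_surjective f.hom
    exact ⟨w, ObjectProperty.hom_ext _ hw⟩⟩
  have : S.Faithful := ⟨fun h => (gridSpine hX k i r).map_injective
    (congrArg (fun w => w.hom) h)⟩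
  refine isIso_toCatHom S ⟨fun a b h => gridSpine_injective hX k i hr
    (congrArg ObjectProperty.FullSubcategory.obj h), fun x => ?_⟩
  obtain ⟨a, ha⟩ := gridSpine_surjective hX k i hr x.obj x.property
  exact ⟨a, ObjectProperty.FullSubcategory.ext ha⟩

/-! ### Isomorphism classes of the model -/

theorem isIso_pCat_map {C D : Cat.{u, u}} (F : C ⟶ D) [F.toFunctor.IsEquivalence] :
    IsIso (pCat.map F) := by
  let G : D ⟶ C := F.toFunctor.inv.toCatHom
  have h₁ : F ≫ G ≅ 𝟙 C := Cat.Hom.isoMk F.toFunctor.asEquivalence.unitIso.symm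
  have h₂ : G ≫ F ≅ 𝟙 D := Cat.Hom.isoMk F.toFunctor.asEquivalence.counitIso
  exact ⟨pCat.map G, (pCat.map_comp F G).symm.trans ((pCat_map_eq h₁).trans (pCat.map_id C)),
    (pCat.map_comp G F).symm.trans ((pCat_map_eq h₂).trans (pCat.map_id D))⟩

/-- Isomorphism classes of a diagram and of a levelwise model agree. -/
noncomputable def LevelwiseModel.psBarIso (M : LevelwiseModel X) :
    (pBar m).obj X ≅ psBar M.pseudofunctor :=
  NatIso.ofComponents
    (fun k => @asIso _ _ (pCat.obj (X.obj k)) (pCat.obj (M.obj k)) (pCat.map (M.unit k))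
      (isIso_pCat_map (M.unit k)))
    (fun {k l} f => by
      have h := pCat_map_eq (Cat.Hom.isoMk (M.square f))
      have h1 : pCat.map (M.unit k ≫ M.map f) = pCat.map (X.map f ≫ M.unit l) := h
      rw [pCat.map_comp, pCat.map_comp] at h1
      exact h1.symm)

theorem IsMultinerveOf.of_iso {m : ℕ} {P : MCat.{u} m → Prop} {Z Z' : Idx (m + 1) ⥤ Type u}
    (h : IsMultinerveOf P Z) (e : Z ≅ Z') : IsMultinerveOf P Z' := by
  obtain ⟨Y, hY, ⟨i⟩⟩ := h
  exact ⟨Y, hY, ⟨i ≪≫ e⟩⟩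

theorem gridModel_isSegalic {m : ℕ} {X : MCat.{u} (m + 1)} (hX : IsMultiSegal X)
    (h : IsMultinerveOf (IsCatWG m) ((pBar (m + 1)).obj X)) :
    IsSegalic m (gridModel hX).pseudofunctor :=
  ⟨⟨gridModel_psDiscrete hX, gridModel_isIso_psSegal hX⟩, h.of_iso (gridModel hX).psBarIso⟩

end WeaklyGlobular

namespace WeaklyGlobular

/-! ### Simplicial sets with bijective Segal maps are nerves -/

section Nerve

variable (S : SSet.{u})

/-- The vertices of a simplex. -/
def vtx {n : ℕ} (z : S.obj (ord n)) (i : Fin (n + 1)) : S.obj (ord 0) :=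
  S.map (SimplexCategory.const (.mk 0) (.mk n) i).op z

/-- The edges of a simplex. -/
def edge {n : ℕ} (z : S.obj (ord n)) (i j : Fin (n + 1)) (h : i ≤ j) : S.obj (ord 1) :=
  S.map (SimplexCategory.mkOfLe i j h).op z

variable {S}

theorem map_map_op {a b c : SimplexCategory} (f : a ⟶ b) (g : b ⟶ c) (z : S.obj (op c)) :
    S.map f.op (S.map g.op z) = S.map (f ≫ g).op z := by
  rw [op_comp, S.map_comp]; rfl

theorem vtx_map {n p : ℕ} (f : SimplexCategory.mk n ⟶ SimplexCategory.mk p) (z : S.obj (ord p))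
    (i : Fin (n + 1)) : vtx S (S.map f.op z) i = vtx S z (f.toOrderHom i) :=
  map_map_op _ _ z

theorem edge_map {n p : ℕ} (f : SimplexCategory.mk n ⟶ SimplexCategory.mk p) (z : S.obj (ord p))
    (i j : Fin (n + 1)) (h : i ≤ j) :
    edge S (S.map f.op z) i j h =
      edge S z (f.toOrderHom i) (f.toOrderHom j) (f.toOrderHom.monotone h) := by
  refine (map_map_op _ _ z).trans ?_
  exact congrArg (fun g => S.map (Quiver.Hom.op g) z) (SimplexCategory.Hom.ext_one_left _ _)

theorem src_edge {n : ℕ} (z : S.obj (ord n)) (i j : Fin (n + 1)) (h : i ≤ j) :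
    S.map srcMap (edge S z i j h) = vtx S z i := by
  refine (map_map_op _ _ z).trans ?_
  exact congrArg (fun g => S.map (Quiver.Hom.op g) z) (SimplexCategory.Hom.ext_zero_left _ _)

theorem tgt_edge {n : ℕ} (z : S.obj (ord n)) (i j : Fin (n + 1)) (h : i ≤ j) :
    S.map tgtMap (edge S z i j h) = vtx S z j := by
  refine (map_map_op _ _ z).trans ?_
  exact congrArg (fun g => S.map (Quiver.Hom.op g) z) (SimplexCategory.Hom.ext_zero_left _ _)

theorem spine_eq_edge {n : ℕ} (z : S.obj (ord n)) (a : Fin n) :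
    S.map (spineMap a) z = edge S z a.castSucc a.succ (Fin.castSucc_le_succ a) :=
  congrArg (fun g => S.map (Quiver.Hom.op g) z) (SimplexCategory.Hom.ext_one_left _ _)

theorem vtx_zero (x : S.obj (ord 0)) : vtx S x 0 = x := by
  have : SimplexCategory.const (.mk 0) (.mk 0) 0 = 𝟙 _ := SimplexCategory.Hom.ext_zero_left _ _
  rw [vtx, this, op_id, S.map_id]; rfl

theorem edge_one (x : S.obj (ord 1)) : edge S x 0 1 (Fin.zero_le _) = x := by
  have : SimplexCategory.mkOfLe (n := 1) 0 1 (Fin.zero_le _) = 𝟙 _ :=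
    SimplexCategory.Hom.ext_one_left _ _
  rw [edge, this, op_id, S.map_id]; rfl

/-- The degenerate edge at a vertex. -/
def degenerateEdge (x : S.obj (ord 0)) : S.obj (ord 1) :=
  S.map (SimplexCategory.const (.mk 1) (.mk 0) 0).op x

theorem edge_self {n : ℕ} (z : S.obj (ord n)) (i : Fin (n + 1)) :
    edge S z i i le_rfl = degenerateEdge (vtx S z i) := by
  refine Eq.trans ?_ (map_map_op _ _ z).symm
  exact congrArg (fun g => S.map (Quiver.Hom.op g) z) (SimplexCategory.Hom.ext_one_left _ _)

variable (S) in
/-- All Segal maps are bijective. -/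
structure IsSegalSet : Prop where
  injective {r : ℕ} (hr : 2 ≤ r) {z w : S.obj (ord r)}
    (h : ∀ a : Fin r, S.map (spineMap a) z = S.map (spineMap a) w) : z = w
  surjective {r : ℕ} (hr : 2 ≤ r) (x : Fin r → S.obj (ord 1))
    (hx : ∀ i j : Fin r, i.val + 1 = j.val → S.map tgtMap (x i) = S.map srcMap (x j)) :
    ∃ z, ∀ a, S.map (spineMap a) z = x a

theorem IsSegalSet.exists_two (h : IsSegalSet S) (f g : S.obj (ord 1))
    (e : S.map tgtMap f = S.map srcMap g) :
    ∃ z : S.obj (ord 2), edge S z 0 1 (by decide) = f ∧ edge S z 1 2 (by decide) = g := by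
  obtain ⟨z, hz⟩ := h.surjective le_rfl ![f, g] (by
    intro i j hij
    fin_cases i <;> fin_cases j <;> simp at hij
    exact e)
  exact ⟨z, (spine_eq_edge z 0).symm.trans (hz 0), (spine_eq_edge z 1).symm.trans (hz 1)⟩

theorem IsSegalSet.exists_three (h : IsSegalSet S) (f g k : S.obj (ord 1))
    (e : S.map tgtMap f = S.map srcMap g) (e' : S.map tgtMap g = S.map srcMap k) :
    ∃ z : S.obj (ord 3), edge S z 0 1 (by decide) = f ∧ edge S z 1 2 (by decide) = g ∧
      edge S z 2 3 (by decide) = k := by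
  obtain ⟨z, hz⟩ := h.surjective (r := 3) (by decide) ![f, g, k] (by
    intro i j hij
    fin_cases i <;> fin_cases j <;> simp at hij
    · exact e
    · exact e')
  exact ⟨z, (spine_eq_edge z 0).symm.trans (hz 0), (spine_eq_edge z 1).symm.trans (hz 1),
    (spine_eq_edge z 2).symm.trans (hz 2)⟩

/-- The composite of two edges. -/
noncomputable def IsSegalSet.compEdge (h : IsSegalSet S) (f g : S.obj (ord 1))
    (e : S.map tgtMap f = S.map srcMap g) : S.obj (ord 1) :=
  edge S (h.exists_two f g e).choose 0 2 (by decide)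

/-- The face of `z` on `i ≤ j ≤ k` has the same spine as the chosen triangle, hence equals it. So
composites may be read off any simplex, which gives the unit and associativity laws. -/
theorem IsSegalSet.compEdge_eq (h : IsSegalSet S) (f g : S.obj (ord 1))
    (e : S.map tgtMap f = S.map srcMap g) {n : ℕ} (z : S.obj (ord n)) (i j k : Fin (n + 1))
    (hij : i ≤ j) (hjk : j ≤ k) (hf : edge S z i j hij = f) (hg : edge S z j k hjk = g) :
    h.compEdge f g e = edge S z i k (hij.trans hjk) := by
  have e1 : (h.exists_two f g e).choose =
      S.map (SimplexCategory.mkOfLeComp i j k hij hjk).op z := by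
    obtain ⟨h1, h2⟩ := (h.exists_two f g e).choose_spec
    refine h.injective le_rfl fun a => ?_
    rw [spine_eq_edge, spine_eq_edge, edge_map]
    fin_cases a
    · exact h1.trans hf.symm
    · exact h2.trans hg.symm
  rw [compEdge, e1, edge_map]
  rfl

theorem src_degenerateEdge (x : S.obj (ord 0)) : S.map srcMap (degenerateEdge x) = x := by
  have e := edge_self x 0
  rw [vtx_zero] at e
  rw [← e, src_edge, vtx_zero]

theorem tgt_degenerateEdge (x : S.obj (ord 0)) : S.map tgtMap (degenerateEdge x) = x := by
  have e := edge_self x 0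
  rw [vtx_zero] at e
  rw [← e, tgt_edge, vtx_zero]

theorem IsSegalSet.src_compEdge (h : IsSegalSet S) (f g : S.obj (ord 1))
    (e : S.map tgtMap f = S.map srcMap g) : S.map srcMap (h.compEdge f g e) = S.map srcMap f := by
  obtain ⟨z, h1, h2⟩ := h.exists_two f g e
  rw [h.compEdge_eq f g e z 0 1 2 (by decide) (by decide) h1 h2, src_edge,
    ← src_edge z 0 1 (by decide), h1]

theorem IsSegalSet.tgt_compEdge (h : IsSegalSet S) (f g : S.obj (ord 1))
    (e : S.map tgtMap f = S.map srcMap g) : S.map tgtMap (h.compEdge f g e) = S.map tgtMap g := by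
  obtain ⟨z, h1, h2⟩ := h.exists_two f g e
  rw [h.compEdge_eq f g e z 0 1 2 (by decide) (by decide) h1 h2, tgt_edge,
    ← tgt_edge z 1 2 (by decide), h2]

/-- The category structure on the vertices of `S`. -/
noncomputable abbrev IsSegalSet.category (h : IsSegalSet S) : Category.{u} (S.obj (ord 0)) where
  Hom x y := {f : S.obj (ord 1) // S.map srcMap f = x ∧ S.map tgtMap f = y}
  id x := ⟨degenerateEdge x, src_degenerateEdge x, tgt_degenerateEdge x⟩
  comp f g := ⟨h.compEdge f.1 g.1 (f.2.2.trans g.2.1.symm),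
    (h.src_compEdge _ _ _).trans f.2.1, (h.tgt_compEdge _ _ _).trans g.2.2⟩
  id_comp {x y} f := by
    apply Subtype.ext
    have h1 : vtx S f.1 0 = x := by rw [← src_edge f.1 0 1 (by decide), edge_one, f.2.1]
    -- The composite is read off `f` itself along the degenerate triangle `0 ≤ 0 ≤ 1`.
    exact (h.compEdge_eq _ _ ((tgt_degenerateEdge x).trans f.2.1.symm) f.1 0 0 1 le_rfl
      (by decide) ((edge_self _ _).trans (by rw [h1])) (edge_one f.1)).trans (edge_one f.1)
  comp_id {x y} f := by
    apply Subtype.ext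
    have h1 : vtx S f.1 1 = y := by rw [← tgt_edge f.1 0 1 (by decide), edge_one, f.2.2]
    exact (h.compEdge_eq _ _ (f.2.2.trans (src_degenerateEdge y).symm) f.1 0 1 1 (by decide)
      le_rfl (edge_one f.1) ((edge_self _ _).trans (by rw [h1]))).trans (edge_one f.1)
  assoc f g k := by
    apply Subtype.ext
    have hfg := f.2.2.trans g.2.1.symm
    have hgk := g.2.2.trans k.2.1.symm
    -- Both bracketings equal the edge from `0` to `3` of this simplex.
    obtain ⟨z, h1, h2, h3⟩ := h.exists_three f.1 g.1 k.1 hfg hgk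
    have e1 := h.compEdge_eq f.1 g.1 hfg z 0 1 2 (by decide) (by decide) h1 h2
    have e2 := h.compEdge_eq g.1 k.1 hgk z 1 2 3 (by decide) (by decide) h2 h3
    exact (h.compEdge_eq _ _ ((h.tgt_compEdge _ _ hfg).trans hgk) z 0 2 3 (by decide) (by decide)
        e1.symm h3).trans
      (h.compEdge_eq _ _ (hfg.trans (h.src_compEdge _ _ hgk).symm) z 0 1 3 (by decide)
        (by decide) h1 e2.symm).symm

/-- The category with nerve `S`. -/
noncomputable def IsSegalSet.cat (h : IsSegalSet S) : Cat.{u, u} :=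
  letI := h.category
  Cat.of (S.obj (ord 0))

variable (h : IsSegalSet S)

/-- The underlying edge of a morphism. -/
def IsSegalSet.val {x y : h.cat} (f : x ⟶ y) : S.obj (ord 1) := f.1

theorem IsSegalSet.val_ext {x y : h.cat} {f g : x ⟶ y} (e : h.val f = h.val g) : f = g :=
  Subtype.ext e

theorem IsSegalSet.val_eqToHom_comp {x x' y y' : h.cat} (p : x = x') (q : y' = y) (f : x' ⟶ y') :
    h.val (eqToHom p ≫ f ≫ eqToHom q) = h.val f := by
  subst p q
  simp

/-- The simplices of `S` as strings of morphisms. -/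
noncomputable def IsSegalSet.toArrows {n : ℕ} (z : S.obj (ord n)) : ComposableArrows h.cat n where
  obj i := vtx S z i
  map {i j} f := ⟨edge S z i j (leOfHom f), src_edge _ _ _ _, tgt_edge _ _ _ _⟩
  map_id i := Subtype.ext (edge_self z i)
  map_comp {i j k} f g := Subtype.ext
    (h.compEdge_eq _ _ ((tgt_edge _ _ _ _).trans (src_edge _ _ _ _).symm) z i j k
      (leOfHom f) (leOfHom g) rfl rfl).symm

theorem IsSegalSet.spine_injective (h : IsSegalSet S) {r : ℕ} {z w : S.obj (ord (r + 1))}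
    (e : ∀ a : Fin (r + 1), S.map (spineMap a) z = S.map (spineMap a) w) : z = w := by
  match r with
  | 0 =>
    have := e 0
    rw [spine_eq_edge, spine_eq_edge] at this
    exact (edge_one z).symm.trans (this.trans (edge_one w))
  | r + 1 => exact h.injective (by omega) e

theorem IsSegalSet.spine_surjective (h : IsSegalSet S) {r : ℕ} (x : Fin (r + 1) → S.obj (ord 1))
    (hx : ∀ i j : Fin (r + 1), i.val + 1 = j.val → S.map tgtMap (x i) = S.map srcMap (x j)) :
    ∃ z, ∀ a, S.map (spineMap a) z = x a := by
  match r with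
  | 0 =>
    refine ⟨x 0, fun a => ?_⟩
    obtain rfl := Subsingleton.elim (α := Fin 1) a 0
    exact (spine_eq_edge _ _).trans (edge_one _)
  | r + 1 => exact h.surjective (by omega) x hx

theorem IsSegalSet.toArrows_injective (n : ℕ) :
    Function.Injective (h.toArrows (n := n)) := by
  intro z w e
  match n with
  | 0 => exact (vtx_zero z).symm.trans ((Functor.congr_obj e 0).trans (vtx_zero w))
  | n + 1 =>
    refine h.spine_injective fun a => ?_
    have := congrArg h.val (Functor.congr_hom e (homOfLE (Fin.castSucc_le_succ a)))
    rw [h.val_eqToHom_comp] at this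
    exact (spine_eq_edge z a).trans (this.trans (spine_eq_edge w a).symm)

theorem IsSegalSet.toArrows_surjective (n : ℕ) :
    Function.Surjective (h.toArrows (n := n)) := by
  intro G
  match n with
  | 0 => exact ⟨G.obj 0, ComposableArrows.ext₀ (vtx_zero _)⟩
  | n + 1 =>
    let x (a : Fin (n + 1)) := G.map (homOfLE (Fin.castSucc_le_succ a))
    obtain ⟨z, hz⟩ := h.spine_surjective (fun a => h.val (x a)) (by
      intro i j hij
      have e : i.succ = j.castSucc := Fin.ext (by simpa using hij)
      exact (x i).2.2.trans ((congrArg G.obj e).trans (x j).2.1.symm))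
    -- The last vertex is the target of the last edge; every other vertex is a source.
    have ho (i : Fin (n + 2)) : vtx S z i = G.obj i := by
      induction i using Fin.lastCases with
      | last =>
        have := hz (Fin.last n)
        rw [spine_eq_edge] at this
        rw [← Fin.succ_last, ← tgt_edge z (Fin.last n).castSucc _ (Fin.castSucc_le_succ _), this]
        exact (x (Fin.last n)).2.2
      | cast i =>
        have := hz i
        rw [spine_eq_edge] at this
        rw [← src_edge z i.castSucc _ (Fin.castSucc_le_succ _), this]
        exact (x i).2.1
    refine ⟨z, ComposableArrows.ext ho fun i hi => h.val_ext ?_⟩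
    exact ((spine_eq_edge z ⟨i, hi⟩).symm.trans (hz ⟨i, hi⟩)).trans
      (h.val_eqToHom_comp _ _ _).symm

/-- A simplicial set with bijective Segal maps maps to the nerve of its category. -/
noncomputable def IsSegalSet.toNerve : S ⟶ nerve h.cat where
  app n := ↾(h.toArrows (n := n.unop.len))
  naturality n p f := by
    ext z
    have ho (i) : vtx S (S.map f z) i = vtx S z (f.unop.toOrderHom i) := vtx_map f.unop z i
    refine CategoryTheory.Functor.ext ho fun i j g => h.val_ext ?_
    exact (edge_map f.unop z i j (leOfHom g)).trans
      (h.val_eqToHom_comp (ho i) (ho j).symm ((h.toArrows z).map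
        (homOfLE (f.unop.toOrderHom.monotone (leOfHom g))))).symm

theorem IsSegalSet.nonempty_nerve_iso : Nonempty (nerve h.cat ≅ S) := by
  have (n : SimplexCategoryᵒᵖ) : IsIso (h.toNerve.app n) := (isIso_iff_bijective _).2
    ⟨h.toArrows_injective n.unop.len, h.toArrows_surjective n.unop.len⟩
  have := NatIso.isIso_of_isIso_app h.toNerve
  exact ⟨(asIso h.toNerve).symm⟩

end Nerve

end WeaklyGlobular

namespace WeaklyGlobular

/-! ### The objects of `LTa_wg` satisfy the weak Segal conditions -/

theorem IsHomDisc.thin_and_isGroupoid : ∀ (m : ℕ) {X : MCat.{u} m} (_ : IsHomDisc m X) (r : Idx m),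
    Quiver.IsThin (X.obj r) ∧ IsGroupoid (X.obj r)
  | 0, X, h, r => by
    obtain rfl := Idx.eq_pt r
    exact h
  | m + 1, X, h, r =>
    IsHomDisc.thin_and_isGroupoid m (h.1 ((Idx.consEquiv m).inverse.obj r).1.unop.len)
      ((Idx.consEquiv m).inverse.obj r).2

/-- `P` is only required to contain the chains of isomorphism classes, so that the fibre products
over `X_0^d` (for `n = 2`) and over `d p̄ X_0` (for `n ≥ 3`) are treated at once. -/
theorem isWeakSegal_of_isEquivalence {F : SimplicialObject Cat.{u, u}}
    (h₀ : Quiver.IsThin (F.obj (ord 0)) ∧ IsGroupoid (F.obj (ord 0)))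
    (P : ∀ r : ℕ, ObjectProperty (Fin r → F.obj (ord 1)))
    (hP : ∀ r, chain (C := F.obj (ord 1)) r (fun x => isoClass ((F.map srcMap).toFunctor.obj x))
      (fun x => isoClass ((F.map tgtMap).toFunctor.obj x)) ≤ P r)
    (L : ∀ r, F.obj (ord r) ⥤ (P r).FullSubcategory)
    (hL : ∀ r, L r ⋙ (P r).ι = Functor.pi' fun a : Fin r => (F.map (spineMap a)).toFunctor)
    (hE : ∀ r, 2 ≤ r → (L r).IsEquivalence) : IsWeakSegal F where
  thin := h₀.1
  groupoid := h₀.2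
  full {r} hr := by
    have := hE r hr
    rw [← hL]
    infer_instance
  faithful {r} hr := by
    have := hE r hr
    rw [← hL]
    infer_instance
  exists_iso {r} hr x hx := by
    have := hE r hr
    let e := (P r).ι.mapIso ((L r).objObjPreimageIso ⟨x, hP r x hx⟩)
    refine ⟨(L r).objPreimage ⟨x, hP r x hx⟩, fun a => ⟨?_⟩⟩
    exact eqToIso (congrFun (Functor.congr_obj (hL r) _) a).symm ≪≫ (Pi.eval _ a).mapIso e

theorem val_eq_of_isoClass_eq {m : ℕ} {S : Type u} {F : MCat.{u} m} (α : F ⟶ (constDisc m).obj S)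
    {r : Idx m} {x y : F.obj r} (h : isoClass x = isoClass y) : val α r x = val α r y := by
  obtain ⟨e⟩ := isoClass_eq_iff.1 h
  exact Discrete.eq_of_hom ((α.app r).toFunctor.map e.hom)

/-- The levelwise equivalences in the definition handle the first direction and the levels `X_k`
handle the others by induction. For `n = 2` the induced Segal maps of `Ta_wg^2` are already
equivalences of categories. -/
theorem IsLTaWG.isMultiSegal : ∀ (m : ℕ) {X : MCat.{u} (m + 1)} (_ : IsLTaWG m X),
    IsMultiSegal X
  | 0, X, h, k, i => by
    obtain rfl := Subsingleton.elim (α := Fin 1) i 0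
    obtain ⟨-, h₀, hE⟩ := h
    refine isWeakSegal_of_isEquivalence (IsHomDisc.thin_and_isGroupoid 0 h₀ _)
      (fun r => chain (C := (level X 1).obj Idx.pt) r (val (srcDisc X) Idx.pt)
        (val (tgtDisc X) Idx.pt)) ?_
      (fun r => ((inducedSegal X r).app Idx.pt).toFunctor) (fun r => rfl) hE
    intro r x hx i j hij
    exact val_eq_of_isoClass_eq (r := Idx.pt) ((discMap 0).app (level X 0)) (hx i j hij)
  | m + 1, X, h, k, i => by
    obtain ⟨h₁, h₂, h₃, -⟩ := h
    induction i using Fin.cases with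
    | zero =>
      exact isWeakSegal_of_isEquivalence (F := Idx.dir (m + 2) k 0 ⋙ X)
        (IsHomDisc.thin_and_isGroupoid (m + 1) h₁.2.1 _) _
        (fun r => le_rfl) (fun r => levelSegal X r ((Idx.consEquiv (m + 1)).inverse.obj k).2)
        (fun r => rfl) (fun r hr => h₃ r hr _)
    | succ j =>
      exact IsLTaWG.isMultiSegal m (h₂ ((Idx.consEquiv (m + 1)).inverse.obj k).1.unop.len)
        ((Idx.consEquiv (m + 1)).inverse.obj k).2 j

/-! ### The truncation condition -/

/-- Injectivity holds because fully faithful functors reflect isomorphism of objects; surjectivity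
is the lifting of chains up to isomorphism. -/
theorem IsWeakSegal.isSegalSet {F : SimplicialObject Cat.{u, u}} (h : IsWeakSegal F) :
    IsSegalSet (F ⋙ pCat) where
  injective {r} hr {z w} e := by
    induction z using Quotient.inductionOn with
    | h z =>
    induction w using Quotient.inductionOn with
    | h w =>
    have := h.full hr
    have := h.faithful hr
    have e' (a : Fin r) : Nonempty ((F.map (spineMap a)).toFunctor.obj z ≅
      (F.map (spineMap a)).toFunctor.obj w) := isoClass_eq_iff.1 (e a)
    exact isoClass_eq_iff.2
      ⟨(Functor.pi' fun a : Fin r => (F.map (spineMap a)).toFunctor).preimageIso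
        (Pi.isoMk fun a => (e' a).some)⟩
  surjective {r} hr x hx := by
    have hy (a : Fin r) : ∃ y : F.obj (ord 1), isoClass y = x a := Quotient.exists_rep (x a)
    choose y hy using hy
    obtain ⟨z, hz⟩ := h.exists_iso hr y fun i j hij => by
      have e := hx i j hij
      rw [← hy, ← hy] at e
      exact e
    exact ⟨isoClass z, fun a => (isoClass_eq_iff.2 (hz a)).trans (hy a)⟩

/-- Functors from `Δ^{op 0}` are isomorphic if their values are. -/
def Idx.natIsoZero {D : Type v} [Category.{w} D] {G H : Idx 0 ⥤ D}
    (e : G.obj Idx.pt ≅ H.obj Idx.pt) : G ≅ H :=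
  NatIso.ofComponents (fun r => eqToIso (by rw [Idx.eq_pt r]) ≪≫ e ≪≫
    eqToIso (by rw [Idx.eq_pt r])) (by
      intro r s f
      obtain rfl := Idx.eq_pt r
      obtain rfl := Idx.eq_pt s
      obtain rfl := Subsingleton.elim f (𝟙 Idx.pt)
      rw [CategoryTheory.Functor.map_id, CategoryTheory.Functor.map_id, Category.id_comp,
        Category.comp_id])

/-- A functor on `Δ^op` is a multinerve if it is a nerve. -/
theorem isMultinerveOf_zero {Z : Idx 1 ⥤ Type u} (C : Cat.{u, u})
    (e : nerve C ≅ ((lastCurry 0).functor.obj Z).obj Idx.pt) :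
    IsMultinerveOf (IsCatWG 0) Z :=
  ⟨(Functor.const (Idx 0)).obj C, trivial,
    ⟨(lastCurry 0).inverse.mapIso (Idx.natIsoZero (G := (Functor.const (Idx 0)).obj C ⋙
      nerveFunctor) e) ≪≫ ((lastCurry 0).unitIso.app Z).symm⟩⟩

/-- Only `n = 2` needs an argument: there `p̄ X` has bijective Segal maps and is therefore the nerve
of a category. -/
theorem IsLTaWG.isMultinerveOf : ∀ (m : ℕ) {X : MCat.{u} (m + 1)} (_ : IsLTaWG m X),
    IsMultinerveOf (IsCatWG m) ((pBar (m + 1)).obj X)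
  | 0, X, h => by
    have hS := (IsLTaWG.isMultiSegal 0 h (Idx.one 1) 0).isSegalSet
    exact isMultinerveOf_zero hS.cat hS.nonempty_nerve_iso.some
  | _ + 1, _, h => h.2.2.2

/-! ### The functor -/

/-- The functor `Tr`. -/
noncomputable def trFunctor (m : ℕ) : LTaWG.{u} m ⥤ SegPs.{u} m where
  obj X := ⟨(gridModel (IsLTaWG.isMultiSegal m X.property)).pseudofunctor,
    gridModel_isSegalic _ (IsLTaWG.isMultinerveOf m X.property)⟩
  map F := ObjectProperty.homMk (gridTrans _ _ F.hom)
  map_id _ := ObjectProperty.hom_ext _ (gridTrans_id _)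
  map_comp F G := ObjectProperty.hom_ext _ (gridTrans_comp _ _ _ F.hom G.hom)

end WeaklyGlobular

/-- With `n = m + 2` (so `n` ranges over all integers `≥ 2`): there is a functor `Tr_n` from
`LTa_wg^n` to the category of Segalic pseudo-functors `Δ^{op (n-1)} → Cat`, together with, for each
object `X` of `LTa_wg^n`, a pseudo-natural transformation `Tr_n X ⟶ X` which is a levelwise
equivalence of categories. -/
theorem mainTheorem4 (m : ℕ) :
    ∃ Tr : WeaklyGlobular.LTaWG.{u} m ⥤ WeaklyGlobular.SegPs.{u} m,
      ∀ X : WeaklyGlobular.LTaWG.{u} m,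
        ∃ t : Pseudofunctor.StrongTrans (Tr.obj X).obj X.obj.toPseudofunctor',
          ∀ k : WeaklyGlobular.Idx (m + 1), (t.app ⟨k⟩).toFunctor.IsEquivalence := by
  refine ⟨WeaklyGlobular.trFunctor m, fun X =>
    ⟨(WeaklyGlobular.gridModel (WeaklyGlobular.IsLTaWG.isMultiSegal m X.property)).counitTrans,
      fun k => ?_⟩⟩
  -- The components of `counitTrans` are the chosen inverses of the comparison equivalences.
  have := (WeaklyGlobular.gridModel (WeaklyGlobular.IsLTaWG.isMultiSegal m X.property)).equiv k
  exact inferInstanceAs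
    ((WeaklyGlobular.gridModel (WeaklyGlobular.IsLTaWG.isMultiSegal m X.property)).unit
      k).toFunctor.inv.IsEquivalence
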